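/- **Setting.** Let $k,\ell$ be fixed integers with $0\le \ell<2k$. Let $G=(V,E)$ be a loopless multigraph with $n=|V|$ vertices and edges $e_1,\dots,e_m$. A subgraph $(V,F)$ is *$(k,\ell)$-sparse* if every $X\subseteq V$ induces at most $\max\{k|X|-\ell,0\}$ edges of $F$. In a $(k,\ell)$-sparse graph, a *block* is a set $X\subseteq V$ that induces exactly $\max\{k|X|-\ell,0\}$ edges, and a *component* is an inclusion-wise maximal block. **Algorithm** (component-based pebble game). It maintains the set $F$ of accepted edges, initially empty; an orientation $D$ of $(V,F)$, with indegrees $\varrho_D$; a bit matrix $M\in\{0,1\}^{V\times V}$; and a list $\mathcal C$ of vertex sets. If $\ell<k$, then initially $M=0$ and $\mathcal C=\emptyset$; otherwise initially $M=I$ and $\mathcal C$ consists of all singletons. The edges $e=uv$ are processed in the order $e_1,\dots,e_m$. If $M_{u,v}=1$ (InCommonComponent), then $e$ is rejected. Otherwise: 1. While $\varrho_D(u)+\varrho_D(v)\ge 2k-\ell$, find by a graph traversal a directed path in $D$ from $S=\{w\in V\setminus\{u,v\}:\varrho_D(w)<k\}$ to $\{u,v\}$, and reverse its arcs. 2. Add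 $e$ to $F$, and to $D$ as an arc into $v$ if $\varrho_D(v)<k$ and into $u$ otherwise. 3. FindComponent: if now $\varrho_D(u)+\varrho_D(v)\ge 2k-\ell$, let $T$ be the set of vertices not reachable in $D$ from $\{w\in V\setminus\{u,v\}:\varrho_D(w)<k\}$; if $u,v\in T$, call UpdateComponents$(C)$ with $C=T$. UpdateComponents$(C)$ starts with $U=\emptyset$ and goes through the sets $X\in\mathcal C$. If $X\subseteq C$ (tested on the first two elements of $X$, or on its only element), it sets $M_{a,b}\gets M_{b,a}\gets 1$ for all $(a,b)\in(U\setminus X)\times(X\setminus U)$ and then merges $X$ into $U$, that is, $U\gets U\cup X$; otherwise $X$ is kept. Finally it sets $M_{a,b}\gets M_{b,a}\gets1$ for $(a,b)\in U\times(C\setminus U)$ and $M_{a,b}\gets 1$ for $(a,b)\in(C\setminus U)^2$, and replaces $\mathcal C$ by $C$ together with the sets that were kept. Differences of sets are computed with characteristic vectors. Time is measured on a unit-cost random access machine. **Theorem.** For all integers $0\le\ell<2k$ there is a constant $c$, depending only on $k$ and $\ell$, such that for every loopless multigraph $G$ with $n$ vertices and $m$ edges $e_1,\dots,e_m$ the algorithm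 terminates, and: - if $n\ge1$, it takes at most $c\,(n^2+m)$ steps; - the set $F$ of accepted edges is $(k,\ell)$-sparse and has the maximum number of edges among all $(k,\ell)$-sparse edge sets of $G$; - for every weight function $w:E\to\mathbb R$ with $w(e_1)\ge\dots\ge w(e_m)$, $F$ has maximum total weight among all maximum-size $(k,\ell)$-sparse edge sets of $G$, and, if $w\ge0$, among all $(k,\ell)$-sparse edge sets of $G$; - at the end, $M_{u,v}=1$ if and only if some component of $(V,F)$ contains both $u$ and $v$, and $\mathcal C$ consists exactly of the non-empty components of $(V,F)$; - the total number of redundant writes (those that set an entry of $M$ to $1$ that already is $1$) is at most $c\,n^2$; - if a call of UpdateComponents merges $t\ge2$ sets $C_1,\dots,C_t$ in this order, then $\sum_{i=1}^t|(C_1\cup\dots\cup C_{i-1})\cap C_i|<2(t-1)$. -/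

import Mathlib

namespace PebbleGame

/-! ## Sparse multigraphs -/

/-- A loopless multigraph with vertex set `Fin n` and edge set `Fin m`. The two endpoints of the
edge `e` are `src e` and `dst e`, parallel edges are allowed. The graph is undirected: the order
in which the two endpoints are stored carries no meaning. -/
structure MultiGraph (n m : ℕ) where
  src : Fin m → Fin n
  dst : Fin m → Fin n
  loopless : ∀ e, src e ≠ dst e

/-- The number `i_F(X)` of edges of `F` that are induced by `X`. -/
def inducedEdges {n m : ℕ} (G : MultiGraph n m) (F : Finset (Fin m)) (X : Finset (Fin n)) : ℕ :=
  (F.filter fun e => G.src e ∈ X ∧ G.dst e ∈ X).card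

/-- The subgraph `(V, F)` is `(k, ℓ)`-sparse: every `X ⊆ V` induces at most
`max {k |X| - ℓ, 0}` of its edges (the subtraction is the truncated one of `ℕ`). -/
def IsSparse {n m : ℕ} (k ℓ : ℕ) (G : MultiGraph n m) (F : Finset (Fin m)) : Prop :=
  ∀ X : Finset (Fin n), inducedEdges G F X ≤ k * X.card - ℓ

/-- `X` is a `(k, ℓ)`-block of the `(k, ℓ)`-sparse graph `(V, F)`: it induces a tight subgraph. -/
def IsBlock {n m : ℕ} (k ℓ : ℕ) (G : MultiGraph n m) (F : Finset (Fin m)) (X : Finset (Fin n)) :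
    Prop :=
  inducedEdges G F X = k * X.card - ℓ

/-- A `(k, ℓ)`-component is an inclusion-wise maximal `(k, ℓ)`-block. -/
def IsComponent {n m : ℕ} (k ℓ : ℕ) (G : MultiGraph n m) (F : Finset (Fin m))
    (X : Finset (Fin n)) : Prop :=
  Maximal (IsBlock k ℓ G F) X

/-! ## The cost model

A unit-cost random access machine. A program of type `Timed α` either diverges or fails (`none`),
or ends with a value and the number of elementary steps that were executed. Every elementary
operation below (arithmetic, comparison, access to an array cell, inspection or extension of a
linked list, one loop iteration) takes one step; creating an array of `N` cells takes `N + 1`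
steps. The procedures further below handle their data by these operations only. -/

/-- A computation with a step count; `none` stands for divergence or failure. -/
def Timed (α : Type) : Type := Option (α × ℕ)

/-- Sequential composition adds the step counts. -/
instance : Monad Timed where
  pure a := some (a, 0)
  bind x f := Option.bind x fun p => Option.bind (f p.1) fun q => some (q.1, p.2 + q.2)

/-- The computation `x` ends with the value `a` after exactly `t` steps. -/
def Timed.EndsWith {α : Type} (x : Timed α) (a : α) (t : ℕ) : Prop := x = some (a, t)

/-- A failing computation. -/
def fail {α : Type} : Timed α := (none : Option (α × ℕ))

/-- One elementary step, with result `a`. -/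
def step {α : Type} (a : α) : Timed α := some (a, 1)

/-- Addition. -/
def add (a b : ℕ) : Timed ℕ := step (a + b)

/-- Subtraction. -/
def sub (a b : ℕ) : Timed ℕ := step (a - b)

/-- Comparison of two numbers. -/
def lt (a b : ℕ) : Timed Bool := step (decide (a < b))

/-- Comparison of two vertices. -/
def same {n : ℕ} (u v : Fin n) : Timed Bool := step (decide (u = v))

/-- Negation of a bit. -/
def bnot (b : Bool) : Timed Bool := step (!b)

/-- Prepend an entry to a linked list. -/
def cons {α : Type} (a : α) (l : List α) : Timed (List α) := step (a :: l)

/-- Is the list non-empty? -/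
def nonempty {α : Type} (l : List α) : Timed Bool := step (!l.isEmpty)

/-- Split a list into its first entry and its tail. -/
def uncons {α : Type} : List α → Timed (Option (α × List α))
  | [] => step none
  | a :: l => step (some (a, l))

/-- Is the pointer non-null? -/
def isSome {α : Type} (a : Option α) : Timed Bool := step a.isSome

/-- Create an array with index set `ι`, all of whose cells hold `a`. -/
def alloc (ι : Type) [Fintype ι] {α : Type} (a : α) : Timed (ι → α) :=
  some (fun _ => a, Fintype.card ι + 1)

/-- Read a cell of an array. -/
def read {ι α : Type} (A : ι → α) (i : ι) : Timed α := step (A i)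

/-- Overwrite a cell of an array. -/
def write {ι α : Type} [DecidableEq ι] (A : ι → α) (i : ι) (a : α) : Timed (ι → α) :=
  step (Function.update A i a)

/-- `for x ∈ l do s ← f s x`: one step per iteration and one for leaving the loop, in addition to
the steps of the loop body. -/
def forEach {α σ : Type} (f : σ → α → Timed σ) : List α → σ → Timed σ
  | [], s => step s
  | x :: xs, s => do
    let s ← step s
    let s ← f s x
    forEach f xs s

/-- `while test s do s ← body s`, cut off (with value `none`) when the test has been evaluated `N`
times without ending the loop. One step per evaluation of the test, in addition to the steps of the
test and of the loop body. -/
def whileUpTo {σ : Type} (test : σ → Timed Bool) (body : σ → Timed σ) : ℕ → σ → Timed σ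
  | 0, _ => fail
  | N + 1, s => do
    let b ← test s
    let b ← step b
    if b then
      let s ← body s
      whileUpTo test body N s
    else pure s

open Classical in
/-- `while test s do s ← body s`, an unbounded loop: it ends as soon as some cut-off loop ends, with
the same value and the same number of steps, and it diverges if there is none. -/
noncomputable def while_ {σ : Type} (test : σ → Timed Bool) (body : σ → Timed σ) (s : σ) : Timed σ :=
  if h : ∃ N, whileUpTo test body N s ≠ fail then whileUpTo test body (Nat.find h) s else fail

/-! ## The orientation `D` -/

/-- The set `F` of accepted edges together with its orientation `D`. The edge `e` is oriented from
`src e` to `dst e` if `flip e = false` and from `dst e` to `src e` otherwise; `indeg` holds the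
indegrees of `D`. -/
structure Orientation (n m : ℕ) where
  arcs : List (Fin m)
  flip : Fin m → Bool
  indeg : Fin n → ℕ

variable {n m : ℕ}

/-- The tail of the arc `e`. -/
def tailOf (G : MultiGraph n m) (D : Orientation n m) (e : Fin m) : Timed (Fin n) := do
  if ← read D.flip e then read G.dst e else read G.src e

/-- The head of the arc `e`. -/
def headOf (G : MultiGraph n m) (D : Orientation n m) (e : Fin m) : Timed (Fin n) := do
  if ← read D.flip e then read G.src e else read G.dst e

/-- The lists of the arcs that leave each vertex. -/
def outLists (G : MultiGraph n m) (D : Orientation n m) : Timed (Fin n → List (Fin m)) := do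
  let out ← alloc (Fin n) []
  forEach (fun out e => do
    let x ← tailOf G D e
    let l ← read out x
    let l ← cons e l
    write out x l) D.arcs out

/-- The state of a graph traversal: the vertices still to be expanded, the reached vertices, and
for each reached vertex that is not a starting vertex the arc along which it was reached. -/
structure Traversal (n m : ℕ) where
  stack : List (Fin n)
  reached : Fin n → Bool
  parent : Fin n → Option (Fin m)

/-- Traverse `D` from the set of starting vertices `{w ∈ V \ {u, v} : ϱ_D(w) < k}`. -/
noncomputable def traverse (k : ℕ) (G : MultiGraph n m) (D : Orientation n m) (u v : Fin n) :
    Timed (Traversal n m) := do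
  let out ← outLists G D
  let reached ← alloc (Fin n) false
  let parent ← alloc (Fin n) none
  let T ← forEach (fun (T : Traversal n m) w => do
    if ← same w u then pure T
    else if ← same w v then pure T
    else
      let d ← read D.indeg w
      if ← lt d k then
        let reached ← write T.reached w true
        let stack ← cons w T.stack
        pure { T with reached := reached, stack := stack }
      else pure T) (List.finRange n) { stack := [], reached := reached, parent := parent }
  while_ (fun T => nonempty T.stack) (fun T => do
    match ← uncons T.stack with
    | none => pure T
    | some (x, rest) =>
      let l ← read out x
      forEach (fun (T : Traversal n m) e => do
        let y ← headOf G D e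
        if ← read T.reached y then pure T
        else
          let reached ← write T.reached y true
          let parent ← write T.parent y (some e)
          let stack ← cons y T.stack
          pure { stack := stack, reached := reached, parent := parent })
        l { T with stack := rest }) T

/-- The arcs of the path from a starting vertex to `y` that was found by the traversal. -/
noncomputable def tracePath (G : MultiGraph n m) (D : Orientation n m) (T : Traversal n m) (y : Fin n) :
    Timed (List (Fin m)) := do
  let s ← while_ (fun (s : Fin n × List (Fin m)) => do
      let p ← read T.parent s.1
      isSome p)
    (fun s => do
      match ← read T.parent s.1 with
      | none => pure s
      | some e =>
        let x ← tailOf G D e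
        let P ← cons e s.2
        pure (x, P)) (y, [])
  pure s.2

/-- Find a path in `D` from `{w ∈ V \ {u, v} : ϱ_D(w) < k}` to `{u, v}`; fail if there is none. -/
noncomputable def findPath (k : ℕ) (G : MultiGraph n m) (D : Orientation n m) (u v : Fin n) :
    Timed (List (Fin m)) := do
  let T ← traverse k G D u v
  if ← read T.reached u then tracePath G D T u
  else if ← read T.reached v then tracePath G D T v
  else fail

/-- Reverse the arcs of the path `P` in `D`. -/
def reversePath (G : MultiGraph n m) (P : List (Fin m)) (D : Orientation n m) :
    Timed (Orientation n m) :=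
  forEach (fun (D : Orientation n m) e => do
    let x ← tailOf G D e
    let y ← headOf G D e
    let dy ← read D.indeg y
    let dy ← sub dy 1
    let indeg ← write D.indeg y dy
    let dx ← read indeg x
    let dx ← add dx 1
    let indeg ← write indeg x dx
    let b ← read D.flip e
    let b ← bnot b
    let flip ← write D.flip e b
    pure { D with indeg := indeg, flip := flip }) P D

/-- `ϱ_D(u) + ϱ_D(v) < 2k - ℓ`? -/
def smallIndeg (k ℓ : ℕ) (D : Orientation n m) (u v : Fin n) : Timed Bool := do
  let du ← read D.indeg u
  let dv ← read D.indeg v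
  let d ← add du dv
  let kk ← add k k
  let bound ← sub kk ℓ
  lt d bound

/-- Reverse paths while `ϱ_D(u) + ϱ_D(v) ≥ 2k - ℓ`. -/
noncomputable def makeRoom (k ℓ : ℕ) (G : MultiGraph n m) (D : Orientation n m) (u v : Fin n) :
    Timed (Orientation n m) :=
  while_ (fun D => do
      let b ← smallIndeg k ℓ D u v
      bnot b)
    (fun D => do
      let P ← findPath k G D u v
      reversePath G P D) D

/-- Insert the edge `e = uv` into `F`, oriented towards `v` if `ϱ_D(v) < k` and towards `u`
otherwise. Here `u = src e` and `v = dst e`. -/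
def insertArc (k : ℕ) (e : Fin m) (u v : Fin n) (D : Orientation n m) :
    Timed (Orientation n m) := do
  let arcs ← cons e D.arcs
  let dv ← read D.indeg v
  if ← lt dv k then
    let flip ← write D.flip e false
    let dv ← add dv 1
    let indeg ← write D.indeg v dv
    pure { arcs := arcs, flip := flip, indeg := indeg }
  else
    let flip ← write D.flip e true
    let du ← read D.indeg u
    let du ← add du 1
    let indeg ← write D.indeg u du
    pure { arcs := arcs, flip := flip, indeg := indeg }

/-- `FindComponent`: the new component as a list of vertices, or the empty list. -/
noncomputable def findComponent (k ℓ : ℕ) (G : MultiGraph n m) (D : Orientation n m) (u v : Fin n) :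
    Timed (List (Fin n)) := do
  if ← smallIndeg k ℓ D u v then pure []
  else
    let Z ← traverse k G D u v
    if ← read Z.reached u then pure []
    else if ← read Z.reached v then pure []
    else
      forEach (fun C w => do
        if ← read Z.reached w then pure C else cons w C) (List.finRange n) []

/-! ## The component data -/

/-- The bit matrix `M` and the list `𝒞` of the current components, each a list of vertices. The
last two fields are a record of the execution, which no instruction reads: `redundant` counts the
writes `M_{u,v} ← 1` that met an entry equal to `1`, and `merged` holds, for each call of
`UpdateComponents`, the components that this call has merged into `U`, in the order of merging. -/
structure CompData (n : ℕ) where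
  M : Fin n × Fin n → Bool
  comps : List (List (Fin n))
  redundant : ℕ
  merged : List (List (List (Fin n)))

/-- `M_{u,v} ← 1`. -/
def setBit (K : CompData n) (u v : Fin n) : Timed (CompData n) := do
  let M ← write K.M (u, v) true
  pure { K with
    M := M
    redundant := if K.M (u, v) = true then K.redundant + 1 else K.redundant }

/-- `M_{u,v} ← M_{v,u} ← 1` for all `(u, v) ∈ A × B`. -/
def markBoth (A B : List (Fin n)) (K : CompData n) : Timed (CompData n) :=
  forEach (fun K u => forEach (fun K v => do
    let K ← setBit K v u
    setBit K u v) B K) A K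

/-- `M_{u,v} ← 1` for all `(u, v) ∈ A × B`. -/
def markOnce (A B : List (Fin n)) (K : CompData n) : Timed (CompData n) :=
  forEach (fun K u => forEach (fun K v => setBit K u v) B K) A K

/-- `InCommonComponent`. -/
def inCommonComponent (K : CompData n) (u v : Fin n) : Timed Bool := read K.M (u, v)

/-- The characteristic vector of a list of vertices. -/
def charVec (l : List (Fin n)) : Timed (Fin n → Bool) := do
  let I ← alloc (Fin n) false
  forEach (fun I w => write I w true) l I

/-- The entries of `l` that do not lie in the set with characteristic vector `I`. -/
def listDiff (l : List (Fin n)) (I : Fin n → Bool) : Timed (List (Fin n)) :=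
  forEach (fun acc w => do
    if ← read I w then pure acc else cons w acc) l []

/-- The test `X ⊆ C`, where `I` is the characteristic vector of `C`: only the first two entries of
`X` (or its only entry) are inspected. -/
def subsetTest (I : Fin n → Bool) (X : List (Fin n)) : Timed Bool := do
  match ← uncons X with
  | none => pure true
  | some (x, rest) =>
    if ← read I x then
      match ← uncons rest with
      | none => pure true
      | some (y, _) => read I y
    else pure false

/-- The local variables of `UpdateComponents`: the component data, the list `U` with its
characteristic vector, the list `𝒞'`, and the record of the components merged so far. -/
structure UpdateState (n : ℕ) where
  data : CompData n
  U : List (Fin n)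
  inU : Fin n → Bool
  newComps : List (List (Fin n))
  log : List (List (Fin n))

/-- The body of the loop over `X ∈ 𝒞` in `UpdateComponents`; `inC` is the characteristic vector of
the new component. -/
def updateStep (inC : Fin n → Bool) (s : UpdateState n) (X : List (Fin n)) :
    Timed (UpdateState n) := do
  if ← subsetTest inC X then
    let inX ← charVec X
    let A ← listDiff s.U inX
    let B ← listDiff X s.inU
    let K ← markBoth A B s.data
    let W ← forEach (fun (W : List (Fin n) × (Fin n → Bool)) w => do
      let U ← cons w W.1
      let inU ← write W.2 w true
      pure (U, inU)) B (s.U, s.inU)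
    pure { s with data := K, U := W.1, inU := W.2, log := s.log ++ [X] }
  else
    let newComps ← cons X s.newComps
    pure { s with newComps := newComps }

/-- `UpdateComponents`. -/
def updateComponents (C : List (Fin n)) (K : CompData n) : Timed (CompData n) := do
  let inC ← charVec C
  let inU ← alloc (Fin n) false
  let init ← cons C []
  let s ← forEach (updateStep inC) K.comps
    { data := K, U := [], inU := inU, newComps := init, log := [] }
  let R ← listDiff C s.inU
  let K ← markBoth s.U R s.data
  let K ← markOnce R R K
  pure { K with comps := s.newComps, merged := s.log :: K.merged }

/-! ## The component-based pebble game -/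

/-- The initial orientation `(V, ∅)`. -/
def initOrientation (n m : ℕ) : Timed (Orientation n m) := do
  let flip ← alloc (Fin m) false
  let indeg ← alloc (Fin n) 0
  pure { arcs := [], flip := flip, indeg := indeg }

/-- The initial component data: `M = 0` and `𝒞 = ∅` if `ℓ < k`; otherwise `M = I` and `𝒞` consists
of the singletons. -/
def initComponents (k ℓ n : ℕ) : Timed (CompData n) := do
  let M ← alloc (Fin n × Fin n) false
  let K : CompData n := { M := M, comps := [], redundant := 0, merged := [] }
  if ← lt ℓ k then pure K
  else forEach (fun (K : CompData n) w => do
    let K ← setBit K w w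
    let X ← cons w []
    let comps ← cons X K.comps
    pure { K with comps := comps }) (List.finRange n) K

/-- Processing one edge. -/
noncomputable def processEdge (k ℓ : ℕ) (G : MultiGraph n m) (s : Orientation n m × CompData n) (e : Fin m) :
    Timed (Orientation n m × CompData n) := do
  let u ← read G.src e
  let v ← read G.dst e
  if ← inCommonComponent s.2 u v then pure s
  else
    let D ← makeRoom k ℓ G s.1 u v
    let D ← insertArc k e u v D
    let C ← findComponent k ℓ G D u v
    if ← nonempty C then
      let K ← updateComponents C s.2
      pure (D, K)
    else pure (D, s.2)

/-- `ComponentPebbleGame`: the edges are processed in the order of their indices. The accepted edges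
are the entries of the list `arcs` of the first component of the result. -/
noncomputable def componentPebbleGame (k ℓ : ℕ) (G : MultiGraph n m) :
    Timed (Orientation n m × CompData n) := do
  let D ← initOrientation n m
  let K ← initComponents k ℓ n
  forEach (processEdge k ℓ G) (List.finRange m) (D, K)

/-- `∑ |U ∩ C_i|`, where `C_1, …, C_t` are the entries of the list and, before `C_i` is treated, `U`
has been enlarged by `C_1, …, C_{i-1}`. -/
def overlapSum (U : Finset (Fin n)) : List (List (Fin n)) → ℕ
  | [] => 0
  | X :: L => (U ∩ X.toFinset).card + overlapSum (U ∪ X.toFinset) L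

end PebbleGame

/-! Sparsity. The number of induced edges is supermodular and `k |X| - ℓ` is modular, so for `ℓ < 2
k` two blocks of a sparse graph that share two vertices have a block as their union
(`IsBlock.union`). Distinct components thus share at most one vertex and, without loops, no edge.
Counting edges component by component shows that a sparse set whose blocks span all edges outside it
is at least as large as any sparse set (`IsSparse.card_le_card`). An edge is rejected exactly when
some block of the edges accepted before it contains both its ends. Hence the accepted edges of every
prefix form a maximum sparse subset of that prefix, and Abel summation turns this into maximum
weight.

Orientation. All indegrees stay at most `k`. A set `X` induces at most as many edges as its
indegrees add up to, with equality iff no arc enters `X`. Let `X` contain `u` and `v`, and call it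
closed if no arc enters it and it contains no starting vertex. If `ϱ(u) + ϱ(v) ≥ 2k - ℓ`, a closed
set is a block (`Consistent.isBlock_of_closed`); if `ϱ(u) + ϱ(v) ≤ 2k - ℓ`, a block is closed
(`Consistent.closed_of_isBlock`). So a failed path search would exhibit a block around the new edge,
which the bit matrix has ruled out; and after the insertion the unreached set, if it contains `u`
and `v`, is the largest block around the new edge.

Time. A rejected edge costs O(1). At most `k n` edges are accepted, each at cost O(n) apart from
merging and writing. Every update adds one set to the list, so there are at most `(k + 1) n` merges
in all, each costing O(n) apart from the writes. The writes are paid for by the ones of `M` and the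
redundant writes. A redundant write at `(a, b)` during the merging of `X` into `U` comes from a
component inside `C` that differs from `X` and from those that brought `a` into `U`; so `a` and `b`
each lie in two merged sets. By `overlapSum_lt` there are fewer than `2 (t - 1)` such vertices when
`t ≥ 2` sets are merged. A call thus makes O(t² + n) redundant writes, and the numbers `t` add up to
O(n). -/

namespace PebbleGame

/-! ## Reasoning about timed computations -/

/-- The computation `x` ends, and its value and its number of steps satisfy `Q`. -/
def wp {α : Type} (x : Timed α) (Q : α → ℕ → Prop) : Prop := ∃ a t, x = some (a, t) ∧ Q a t

section Calculus

variable {α β σ : Type}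

theorem wp_mono {x : Timed α} {Q R : α → ℕ → Prop} (hx : wp x Q) (h : ∀ a t, Q a t → R a t) :
    wp x R := by
  obtain ⟨a, t, hx, hQ⟩ := hx
  exact ⟨a, t, hx, h a t hQ⟩

@[simp] theorem wp_some (a : α) (t : ℕ) (Q : α → ℕ → Prop) :
    wp (some (a, t) : Option (α × ℕ)) Q ↔ Q a t := by
  constructor
  · rintro ⟨a', t', h, hQ⟩
    obtain ⟨rfl, rfl⟩ := Prod.mk.inj (Option.some.inj h)
    exact hQ
  · exact fun h => ⟨a, t, rfl, h⟩

@[simp] theorem wp_pure (a : α) (Q : α → ℕ → Prop) : wp (pure a : Timed α) Q ↔ Q a 0 :=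
  wp_some a 0 Q

@[simp] theorem wp_step (a : α) (Q : α → ℕ → Prop) : wp (step a) Q ↔ Q a 1 :=
  wp_some a 1 Q

@[simp] theorem wp_bind (x : Timed α) (f : α → Timed β) (Q : β → ℕ → Prop) :
    wp (x >>= f) Q ↔ wp x fun a s => wp (f a) fun b t => Q b (s + t) := by
  constructor
  · rintro ⟨b, t, h, hQ⟩
    rcases x with _ | ⟨a, s⟩
    · cases h
    · have h : Option.bind (f a) (fun q => some (q.1, s + q.2)) = some (b, t) := h
      rcases hf : f a with _ | ⟨b', t'⟩
      · rw [hf] at h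
        cases h
      · rw [hf] at h
        obtain ⟨rfl, rfl⟩ := Prod.mk.inj (Option.some.inj h)
        exact ⟨a, s, rfl, b', t', hf, hQ⟩
  · rintro ⟨a, s, rfl, b, t, hf, hQ⟩
    refine ⟨b, s + t, ?_, hQ⟩
    change Option.bind (f a) (fun q => some (q.1, s + q.2)) = _
    rw [hf]
    rfl

theorem wp_ite (p : Prop) [Decidable p] (x y : Timed α) (Q : α → ℕ → Prop) :
    wp (if p then x else y) Q ↔ (p → wp x Q) ∧ (¬p → wp y Q) := by
  split_ifs with h <;> simp [h]

@[simp] theorem wp_read {ι : Type} (A : ι → α) (i : ι) (Q : α → ℕ → Prop) :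
    wp (read A i) Q ↔ Q (A i) 1 := wp_step _ _

@[simp] theorem wp_write {ι : Type} [DecidableEq ι] (A : ι → α) (i : ι) (a : α)
    (Q : (ι → α) → ℕ → Prop) : wp (write A i a) Q ↔ Q (Function.update A i a) 1 := wp_step _ _

@[simp] theorem wp_alloc {ι : Type} [Fintype ι] (a : α) (Q : (ι → α) → ℕ → Prop) :
    wp (alloc ι a) Q ↔ Q (fun _ => a) (Fintype.card ι + 1) := wp_some _ _ _

@[simp] theorem wp_add (a b : ℕ) (Q : ℕ → ℕ → Prop) : wp (add a b) Q ↔ Q (a + b) 1 := wp_step _ _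

@[simp] theorem wp_sub (a b : ℕ) (Q : ℕ → ℕ → Prop) : wp (sub a b) Q ↔ Q (a - b) 1 := wp_step _ _

@[simp] theorem wp_lt (a b : ℕ) (Q : Bool → ℕ → Prop) : wp (lt a b) Q ↔ Q (decide (a < b)) 1 :=
  wp_step _ _

@[simp] theorem wp_same {n : ℕ} (u v : Fin n) (Q : Bool → ℕ → Prop) :
    wp (same u v) Q ↔ Q (decide (u = v)) 1 := wp_step _ _

@[simp] theorem wp_bnot (b : Bool) (Q : Bool → ℕ → Prop) : wp (bnot b) Q ↔ Q (!b) 1 := wp_step _ _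

@[simp] theorem wp_cons (a : α) (l : List α) (Q : List α → ℕ → Prop) :
    wp (cons a l) Q ↔ Q (a :: l) 1 := wp_step _ _

@[simp] theorem wp_nonempty (l : List α) (Q : Bool → ℕ → Prop) :
    wp (nonempty l) Q ↔ Q (!l.isEmpty) 1 := wp_step _ _

@[simp] theorem wp_isSome (a : Option α) (Q : Bool → ℕ → Prop) :
    wp (isSome a) Q ↔ Q a.isSome 1 := wp_step _ _

@[simp] theorem wp_uncons_nil (Q : Option (α × List α) → ℕ → Prop) :
    wp (uncons []) Q ↔ Q none 1 := wp_step _ _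

@[simp] theorem wp_uncons_cons (a : α) (l : List α) (Q : Option (α × List α) → ℕ → Prop) :
    wp (uncons (a :: l)) Q ↔ Q (some (a, l)) 1 := wp_step _ _

/-- Loops over lists: `I xs s t` holds if the entries `xs` remain, after `t` steps. -/
theorem wp_forEach {f : σ → α → Timed σ} {l : List α} {s : σ} {Q : σ → ℕ → Prop}
    (I : List α → σ → ℕ → Prop) (h0 : I l s 0)
    (hstep : ∀ x xs s t, I (x :: xs) s t → wp (f s x) fun s' t' => I xs s' (t + 1 + t'))
    (hend : ∀ s t, I [] s t → Q s (t + 1)) : wp (forEach f l s) Q := by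
  suffices H : ∀ (l : List α) (s : σ) (t : ℕ), I l s t →
      wp (forEach f l s) fun s' t' => Q s' (t + t') by
    simpa using H l s 0 h0
  intro l
  induction l with
  | nil =>
    intro s t h
    simpa [forEach] using hend s t h
  | cons x xs ih =>
    intro s t h
    simp only [forEach, wp_bind, wp_step]
    refine wp_mono (hstep x xs s t h) fun s' t' h' => wp_mono (ih s' _ h') fun a r hr => ?_
    simpa only [Nat.add_assoc] using hr

/-- Loops over lists whose body takes at most `c` steps. -/
theorem wp_forEach_le {f : σ → α → Timed σ} {l : List α} {s : σ} (c : ℕ)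
    (J : List α → σ → Prop) (h0 : J l s)
    (hstep : ∀ x xs s, J (x :: xs) s → wp (f s x) fun s' t => J xs s' ∧ t ≤ c) :
    wp (forEach f l s) fun s' t => J [] s' ∧ t ≤ (c + 1) * l.length + 1 := by
  refine wp_forEach (fun xs s t => J xs s ∧ t + (c + 1) * xs.length ≤ (c + 1) * l.length)
    ⟨h0, by simp⟩ ?_ ?_
  · rintro x xs s t ⟨hJ, ht⟩
    refine wp_mono (hstep x xs s hJ) fun s' t' h => ⟨h.1, ?_⟩
    have := h.2
    simp only [List.length_cons, Nat.mul_add, Nat.mul_one] at ht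
    omega
  · rintro s t ⟨hJ, ht⟩
    exact ⟨hJ, by simpa using ht⟩

theorem wp_whileUpTo_succ {test : σ → Timed Bool} {body : σ → Timed σ} (N : ℕ) :
    ∀ (s : σ) (Q : σ → ℕ → Prop), wp (whileUpTo test body N s) Q →
      wp (whileUpTo test body (N + 1) s) Q := by
  induction N with
  | zero =>
    rintro s Q ⟨a, t, h, -⟩
    cases h
  | succ N ih =>
    intro s Q h
    rw [whileUpTo] at h ⊢
    simp only [wp_bind, wp_step, wp_ite] at h ⊢
    exact wp_mono h fun b t hb =>
      ⟨fun h' => wp_mono (hb.1 h') fun s' t' hs' => ih _ _ hs', hb.2⟩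

/-- A larger cut-off does not change a run that has ended, so the least successful cut-off used by
`while_` gives the same value and step count as `N`. -/
theorem wp_while_of_whileUpTo {test : σ → Timed Bool} {body : σ → Timed σ} {s : σ} {N : ℕ}
    {Q : σ → ℕ → Prop} (h : wp (whileUpTo test body N s) Q) : wp (while_ test body s) Q := by
  classical
  have hex : ∃ N, whileUpTo test body N s ≠ fail := by
    obtain ⟨a, t, h, -⟩ := h
    exact ⟨N, by rw [h]; exact Option.some_ne_none _⟩
  have hmono : ∀ M d (R : σ → ℕ → Prop), wp (whileUpTo test body M s) R →
      wp (whileUpTo test body (M + d) s) R := by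
    intro M d R hM
    induction d with
    | zero => exact hM
    | succ d ih => exact wp_whileUpTo_succ _ _ _ ih
  have hN : whileUpTo test body N s ≠ fail := by
    obtain ⟨a, t, h, -⟩ := h
    rw [h]
    exact Option.some_ne_none _
  rw [while_, dif_pos hex]
  obtain ⟨d, hd⟩ := Nat.exists_eq_add_of_le (Nat.find_min' hex hN)
  obtain ⟨⟨a, t⟩, hat⟩ := Option.ne_none_iff_exists'.1 (Nat.find_spec hex)
  obtain ⟨a', t', h', hQ⟩ := h
  obtain ⟨a'', t'', h'', rfl, rfl⟩ := hmono _ d (fun b r => b = a ∧ r = t) ⟨a, t, hat, rfl, rfl⟩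
  rw [← hd, h'] at h''
  obtain ⟨rfl, rfl⟩ := Prod.mk.inj (Option.some.inj h'')
  exact ⟨_, _, hat, hQ⟩

/-- Unbounded loops: the potential `pot` pays for all steps. -/
theorem wp_while {test : σ → Timed Bool} {body : σ → Timed σ} {s : σ} {Q : σ → Prop}
    (I : σ → Prop) (pot : σ → ℕ) (h0 : I s)
    (hstep : ∀ s, I s → wp (test s) fun b t =>
      (b = true → wp (body s) fun s' t' => I s' ∧ t + 1 + t' + pot s' ≤ pot s) ∧
      (b = false → Q s ∧ t + 1 ≤ pot s)) :
    wp (while_ test body s) fun s' t => Q s' ∧ t ≤ pot s := by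
  -- Each iteration lowers the potential by at least one, so a cut-off above the potential is never
  -- met.
  have H : ∀ N s, I s → pot s < N →
      wp (whileUpTo test body N s) fun s' t => Q s' ∧ t ≤ pot s := by
    intro N
    induction N with
    | zero => exact fun s _ h => absurd h (Nat.not_lt_zero _)
    | succ N ih =>
      intro s hs hN
      simp only [whileUpTo, wp_bind, wp_step]
      refine wp_mono (hstep s hs) fun b t hb => ?_
      cases b
      · have := hb.2 rfl
        simpa using this
      · simp only [if_true, wp_bind]
        refine wp_mono (hb.1 rfl) fun s' t' h => ?_
        refine wp_mono (ih s' h.1 (by omega)) fun s'' t'' h' => ⟨h'.1, ?_⟩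
        omega
  exact wp_while_of_whileUpTo (H _ s h0 (Nat.lt_succ_self _))

end Calculus

/-! ## Blocks and components -/

section Sparse

variable {n m k ℓ : ℕ} {G : MultiGraph n m} {F F' : Finset (Fin m)} {X Y : Finset (Fin n)}

theorem inducedEdges_mono (h : F ⊆ F') (X : Finset (Fin n)) :
    inducedEdges G F X ≤ inducedEdges G F' X :=
  Finset.card_le_card (Finset.filter_subset_filter _ h)

theorem inducedEdges_univ : inducedEdges G F Finset.univ = F.card := by
  simp [inducedEdges]

theorem inducedEdges_supermodular (X Y : Finset (Fin n)) :
    inducedEdges G F X + inducedEdges G F Y ≤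
      inducedEdges G F (X ∪ Y) + inducedEdges G F (X ∩ Y) := by
  unfold inducedEdges
  rw [← Finset.card_union_add_card_inter]
  refine Nat.add_le_add (Finset.card_le_card fun e => ?_) (Finset.card_le_card fun e => ?_)
  · simp only [Finset.mem_union, Finset.mem_filter]
    tauto
  · simp only [Finset.mem_inter, Finset.mem_filter]
    tauto

theorem inducedEdges_insert {e : Fin m} (he : e ∉ F) :
    inducedEdges G (insert e F) X =
      inducedEdges G F X + if G.src e ∈ X ∧ G.dst e ∈ X then 1 else 0 := by
  unfold inducedEdges
  rw [Finset.filter_insert]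
  split_ifs
  · rw [Finset.card_insert_of_notMem (by simp [he])]
  · rfl

theorem IsSparse.mono (hF : IsSparse k ℓ G F') (h : F ⊆ F') : IsSparse k ℓ G F :=
  fun X => (inducedEdges_mono h X).trans (hF X)

theorem IsSparse.card_le (hF : IsSparse k ℓ G F) : F.card ≤ k * n := by
  have := hF Finset.univ
  rw [inducedEdges_univ, Finset.card_univ, Fintype.card_fin] at this
  omega

/-- A block of a subgraph of a sparse graph is a block. -/
theorem IsBlock.mono (hX : IsBlock k ℓ G F X) (hF : IsSparse k ℓ G F') (h : F ⊆ F') :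
    IsBlock k ℓ G F' X :=
  le_antisymm (hF X) (hX.symm.le.trans (inducedEdges_mono h X))

theorem lt_mul_card (hℓ : ℓ < 2 * k) (hX : 2 ≤ X.card) : ℓ < k * X.card := by
  have := Nat.mul_le_mul_left k hX
  omega

/-- Since `ℓ < 2 k`, the bound is not truncated on sets with two or more vertices, hence on none of
the four sets involved. It is modular there, and supermodularity of the edge count forces equality
for the union. -/
theorem IsBlock.union (hℓ : ℓ < 2 * k) (hF : IsSparse k ℓ G F) (hX : IsBlock k ℓ G F X)
    (hY : IsBlock k ℓ G F Y) (h : 2 ≤ (X ∩ Y).card) : IsBlock k ℓ G F (X ∪ Y) := by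
  refine le_antisymm (hF _) ?_
  have h1 := inducedEdges_supermodular (G := G) (F := F) X Y
  have h2 := hF (X ∩ Y)
  have h3 := lt_mul_card hℓ h
  have h4 := Nat.mul_le_mul_left k (Finset.card_le_card (Finset.inter_subset_left (s₁ := X) (s₂ := Y)))
  have h5 := Nat.mul_le_mul_left k
    (Finset.card_le_card (Finset.inter_subset_right (s₁ := X) (s₂ := Y)))
  have h6 := congrArg (k * ·) (Finset.card_union_add_card_inter X Y)
  simp only [Nat.mul_add] at h6
  unfold IsBlock at hX hY
  omega

theorem IsBlock.exists_component (hX : IsBlock k ℓ G F X) :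
    ∃ Y, IsComponent k ℓ G F Y ∧ X ⊆ Y := by
  obtain ⟨Y, h, hY⟩ := Finite.exists_le_maximal hX
  exact ⟨Y, hY, h⟩

theorem IsComponent.card_inter_le_one (hℓ : ℓ < 2 * k) (hF : IsSparse k ℓ G F)
    (hX : IsComponent k ℓ G F X) (hY : IsComponent k ℓ G F Y) (hne : X ≠ Y) :
    (X ∩ Y).card ≤ 1 := by
  by_contra! h
  have hU := hX.1.union hℓ hF hY.1 h
  exact hne ((hX.eq_of_le hU Finset.subset_union_left).trans
    (hY.eq_of_le hU Finset.subset_union_right).symm)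

theorem IsComponent.eq_of_mem (hℓ : ℓ < 2 * k) (hF : IsSparse k ℓ G F)
    (hX : IsComponent k ℓ G F X) (hY : IsComponent k ℓ G F Y) {a b : Fin n} (hab : a ≠ b)
    (haX : a ∈ X) (hbX : b ∈ X) (haY : a ∈ Y) (hbY : b ∈ Y) : X = Y := by
  by_contra hne
  exact hab (Finset.card_le_one.1 (hX.card_inter_le_one hℓ hF hY hne) a
    (Finset.mem_inter.2 ⟨haX, haY⟩) b (Finset.mem_inter.2 ⟨hbX, hbY⟩))

/-- Different components of a sparse graph have no edge in common. -/
theorem sum_inducedEdges_eq (hℓ : ℓ < 2 * k) (hF : IsSparse k ℓ G F)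
    (𝒞 : Finset (Finset (Fin n))) (h𝒞 : ∀ X ∈ 𝒞, IsComponent k ℓ G F X) :
    ∑ X ∈ 𝒞, inducedEdges G F X =
      (𝒞.biUnion fun X => F.filter fun e => G.src e ∈ X ∧ G.dst e ∈ X).card := by
  rw [Finset.card_biUnion]
  · rfl
  · intro X hX Y hY hne
    rw [Function.onFun, Finset.disjoint_left]
    intro e h1 h2
    rw [Finset.mem_filter] at h1 h2
    exact hne ((h𝒞 X hX).eq_of_mem hℓ hF (h𝒞 Y hY) (G.loopless e) h1.2.1 h1.2.2 h2.2.1 h2.2.2)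

/-- A sparse edge set `F` that spans `F'` by its blocks has at least as many edges as `F'`. -/
theorem IsSparse.card_le_card (hℓ : ℓ < 2 * k) (hF : IsSparse k ℓ G F)
    (hF' : IsSparse k ℓ G F')
    (h : ∀ e ∈ F', e ∉ F → ∃ X, IsBlock k ℓ G F X ∧ G.src e ∈ X ∧ G.dst e ∈ X) :
    F'.card ≤ F.card := by
  classical
  set 𝒞 : Finset (Finset (Fin n)) := Finset.univ.filter fun X => IsComponent k ℓ G F X with h𝒞
  have hmem : ∀ X ∈ 𝒞, IsComponent k ℓ G F X := fun X hX => (Finset.mem_filter.1 hX).2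
  set A := 𝒞.biUnion fun X => F.filter fun e => G.src e ∈ X ∧ G.dst e ∈ X with hA
  set B := 𝒞.biUnion fun X => F'.filter fun e => G.src e ∈ X ∧ G.dst e ∈ X with hB
  have hAF : A ⊆ F := Finset.biUnion_subset.2 fun X _ => Finset.filter_subset _ _
  have hsub : F' ⊆ B ∪ F \ A := by
    intro e he
    rw [Finset.mem_union, Finset.mem_sdiff]
    by_cases heF : e ∈ F
    · by_cases heA : e ∈ A
      · obtain ⟨X, hX, heX⟩ := Finset.mem_biUnion.1 heA
        exact Or.inl (Finset.mem_biUnion.2 ⟨X, hX, Finset.mem_filter.2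
          ⟨he, (Finset.mem_filter.1 heX).2⟩⟩)
      · exact Or.inr ⟨heF, heA⟩
    · obtain ⟨X, hX, h1, h2⟩ := h e he heF
      obtain ⟨Y, hY, hXY⟩ := hX.exists_component
      exact Or.inl (Finset.mem_biUnion.2 ⟨Y, Finset.mem_filter.2 ⟨Finset.mem_univ _, hY⟩,
        Finset.mem_filter.2 ⟨he, hXY h1, hXY h2⟩⟩)
  -- Each component is tight for `F`, so it holds no more edges of `F'` than of `F`. The components
  -- have no common edges of `F`, whereas for `F'` the union bound suffices.
  have h1 : B.card ≤ A.card := by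
    rw [hA, ← sum_inducedEdges_eq hℓ hF 𝒞 hmem]
    refine Finset.card_biUnion_le.trans (Finset.sum_le_sum fun X hX => ?_)
    rw [(hmem X hX).1]
    exact hF' X
  have h2 := (Finset.card_le_card hsub).trans (Finset.card_union_le _ _)
  rw [Finset.card_sdiff_of_subset hAF] at h2
  have h3 := Finset.card_le_card hAF
  omega

/-! ## Overlaps among components -/

/-- Adding a set to `U` enlarges it by the size of the set minus the overlap; the sum telescopes. -/
theorem overlapSum_add_card (L : List (List (Fin n))) : ∀ U : Finset (Fin n),
    overlapSum U L + (L.foldl (fun U X => U ∪ X.toFinset) U).card =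
      U.card + (L.map fun X => X.toFinset.card).sum := by
  induction L with
  | nil => simp [overlapSum]
  | cons X L ih =>
    intro U
    have h1 := ih (U ∪ X.toFinset)
    have h2 := Finset.card_union_add_card_inter U X.toFinset
    simp only [overlapSum, List.foldl_cons, List.map_cons, List.sum_cons]
    omega

theorem mem_foldl_union {a : Fin n} (L : List (List (Fin n))) : ∀ U : Finset (Fin n),
    a ∈ L.foldl (fun U X => U ∪ X.toFinset) U ↔ a ∈ U ∨ ∃ X ∈ L, a ∈ X := by
  induction L with
  | nil => simp
  | cons X L ih =>
    intro U
    rw [List.foldl_cons, ih]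
    simp [or_assoc]

/-- The vertices that lie in two entries of the list are among the overlaps. -/
theorem exists_card_le_overlapSum (L : List (List (Fin n))) : ∀ U : Finset (Fin n),
    ∃ W : Finset (Fin n), W.card ≤ overlapSum U L ∧
      (∀ X ∈ L, ∀ a ∈ U, a ∈ X → a ∈ W) ∧
      L.Pairwise fun X Y => ∀ a ∈ X, a ∈ Y → a ∈ W := by
  induction L with
  | nil => exact fun U => ⟨∅, by simp⟩
  | cons X L ih =>
    intro U
    obtain ⟨W, h1, h2, h3⟩ := ih (U ∪ X.toFinset)
    refine ⟨(U ∩ X.toFinset) ∪ W, ?_, ?_, ?_⟩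
    · exact (Finset.card_union_le _ _).trans (Nat.add_le_add_left h1 _)
    · intro Y hY a haU haY
      rcases List.mem_cons.1 hY with rfl | hY
      · simp [haU, haY]
      · exact Finset.mem_union_right _ (h2 Y hY a (Finset.mem_union_left _ haU) haY)
    · rw [List.pairwise_cons]
      refine ⟨fun Y hY a haX haY => Finset.mem_union_right _
        (h2 Y hY a (Finset.mem_union_right _ (List.mem_toFinset.2 haX)) haY), ?_⟩
      exact h3.imp fun h a ha hb => Finset.mem_union_right _ (h a ha hb)

/-- With `U` the union of the `t` components, edge-disjointness and sparsity of `U` give `∑ (k |C_i|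
- ℓ) ≤ k |U| - ℓ`. By `overlapSum_add_card` the overlap is `∑ |C_i| - |U|`, so `k` times it is at
most `(t - 1) ℓ < 2 k (t - 1)`. -/
theorem overlapSum_lt (hℓ : ℓ < 2 * k) (hF : IsSparse k ℓ G F) (L : List (List (Fin n)))
    (hL : ∀ X ∈ L, X ≠ [] ∧ IsComponent k ℓ G F X.toFinset) (hnd : (L.map List.toFinset).Nodup)
    (h2 : 2 ≤ L.length) : overlapSum ∅ L < 2 * (L.length - 1) := by
  classical
  set U := L.foldl (fun U X => U ∪ X.toFinset) ∅ with hU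
  have hid := overlapSum_add_card L ∅
  rw [← hU, Finset.card_empty, Nat.zero_add] at hid
  have hmemU : ∀ X ∈ L, X.toFinset ⊆ U := fun X hX a ha =>
    (mem_foldl_union L ∅).2 (Or.inr ⟨X, hX, List.mem_toFinset.1 ha⟩)
  -- Two different non-empty sets cannot both fit into one vertex. This keeps `k |U| - ℓ` from being
  -- truncated.
  have hUcard : 2 ≤ U.card := by
    obtain ⟨X, Y, L', rfl⟩ : ∃ X Y L', L = X :: Y :: L' := by
      match L, h2 with
      | X :: Y :: L', _ => exact ⟨X, Y, L', rfl⟩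
    by_contra! hlt
    have hX := hL X (by simp)
    have hY := hL Y (by simp)
    have hXU := hmemU X (by simp)
    have hYU := hmemU Y (by simp)
    have key : ∀ Z : List (Fin n), Z ≠ [] → Z.toFinset ⊆ U → Z.toFinset = U := fun Z hZ hZU =>
      Finset.eq_of_subset_of_card_le hZU (by
        have := Finset.card_pos.2 (List.toFinset_nonempty_iff Z |>.2 hZ)
        omega)
    have heq := (key X hX.1 hXU).trans (key Y hY.1 hYU).symm
    simp [heq] at hnd
  have hsum : (L.map fun X => inducedEdges G F X.toFinset).sum ≤ inducedEdges G F U := by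
    have h1 := sum_inducedEdges_eq hℓ hF (L.map List.toFinset).toFinset (by
      intro X hX
      obtain ⟨Y, hY, rfl⟩ := List.mem_map.1 (List.mem_toFinset.1 hX)
      exact (hL Y hY).2)
    rw [List.sum_toFinset _ hnd, List.map_map] at h1
    refine h1.le.trans (Finset.card_le_card (Finset.biUnion_subset.2 fun X hX e he => ?_))
    obtain ⟨Y, hY, rfl⟩ := List.mem_map.1 (List.mem_toFinset.1 hX)
    rw [Finset.mem_filter] at he ⊢
    exact ⟨he.1, hmemU Y hY he.2.1, hmemU Y hY he.2.2⟩
  have hblocks : k * (L.map fun X => X.toFinset.card).sum ≤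
      (L.map fun X => inducedEdges G F X.toFinset).sum + L.length * ℓ := by
    have : ∀ L' : List (List (Fin n)), (∀ X ∈ L', X ∈ L) →
        k * (L'.map fun X => X.toFinset.card).sum ≤
          (L'.map fun X => inducedEdges G F X.toFinset).sum + L'.length * ℓ := by
      intro L'
      induction L' with
      | nil => simp
      | cons X L' ih =>
        intro h
        have h1 := ih fun Y hY => h Y (List.mem_cons_of_mem _ hY)
        have h2 : inducedEdges G F X.toFinset = _ := (hL X (h X List.mem_cons_self)).2.1
        simp only [List.map_cons, List.sum_cons, List.length_cons, Nat.mul_add, Nat.add_mul]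
        omega
    exact this L fun _ h => h
  have hFU := hF U
  have hlt := lt_mul_card hℓ hUcard
  rw [← hid, Nat.mul_add] at hblocks
  have hk : k * overlapSum ∅ L ≤ (L.length - 1) * ℓ := by
    rw [Nat.sub_mul]
    omega
  have hpos : 0 < L.length - 1 := by omega
  have h3 : k * overlapSum ∅ L < k * (2 * (L.length - 1)) := by
    calc _ ≤ (L.length - 1) * ℓ := hk
      _ < (L.length - 1) * (2 * k) := (Nat.mul_lt_mul_left hpos).2 hℓ
      _ = _ := by ring
  exact Nat.lt_of_mul_lt_mul_left h3

/-! ## Greedy edge sets have maximum weight -/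

/-- Abel summation by induction: the weight of the last index serves as the constant `c` for the
shorter sequence, and the total of `f`, being nonnegative, allows it to be replaced by the smaller
`c`. -/
theorem mul_sum_le_sum_mul_of_antitone {m : ℕ} (f w : Fin m → ℝ) (c : ℝ) (hw : Antitone w)
    (hc : ∀ i, c ≤ w i) (hf : ∀ j, 0 ≤ ∑ i with i ≤ j, f i) :
    c * ∑ i, f i ≤ ∑ i, f i * w i := by
  induction m generalizing c with
  | zero => simp
  | succ m ih =>
    have h1 := ih (fun i => f i.castSucc) (fun i => w i.castSucc) (w (Fin.last m))
      (fun i j h => hw (Fin.castSucc_le_castSucc_iff.2 h)) (fun i => hw (Fin.le_last _)) (by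
        intro j
        have := hf j.castSucc
        rw [Finset.sum_filter] at this ⊢
        rw [Fin.sum_univ_castSucc] at this
        simpa [Fin.castSucc_le_castSucc_iff, (Fin.castSucc_lt_last j).not_ge] using this)
    have h2 : 0 ≤ ∑ i, f i := by
      have := hf (Fin.last m)
      simpa [Fin.le_last] using this
    rw [Fin.sum_univ_castSucc] at h2 ⊢
    rw [Fin.sum_univ_castSucc]
    have h3 := mul_le_mul_of_nonneg_right (hc (Fin.last m)) h2
    linarith

/-- Abel summation for the difference of the indicators of `F` and `F'`, whose partial sums are
nonnegative. With equal sizes the total vanishes and any lower bound of the weights serves as the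
constant; with nonnegative weights the constant is `0`. -/
theorem sum_le_sum_of_card_prefix_le {F F' : Finset (Fin m)} (w : Fin m → ℝ) (hw : Antitone w)
    (h : ∀ j, (F'.filter (· ≤ j)).card ≤ (F.filter (· ≤ j)).card)
    (hlast : F'.card = F.card ∨ ∀ e, 0 ≤ w e) : ∑ e ∈ F', w e ≤ ∑ e ∈ F, w e := by
  set f : Fin m → ℝ := fun e => (if e ∈ F then 1 else 0) - if e ∈ F' then 1 else 0 with hf
  have hfw : ∑ e, f e * w e = ∑ e ∈ F, w e - ∑ e ∈ F', w e := by
    simp [hf, sub_mul, Finset.sum_sub_distrib]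
  have hf1 : ∑ e, f e = F.card - F'.card := by
    simp [hf, Finset.sum_sub_distrib]
  have hfj : ∀ j, 0 ≤ ∑ i with i ≤ j, f i := by
    intro j
    have h1 : ∀ A : Finset (Fin m), (∑ i with i ≤ j, if i ∈ A then (1 : ℝ) else 0) =
        (A.filter (· ≤ j)).card := by
      intro A
      rw [Finset.sum_ite_mem, Finset.sum_const, nsmul_one]
      congr 2
      ext
      simp [and_comm]
    rw [Finset.sum_sub_distrib, h1, h1, sub_nonneg]
    exact_mod_cast h j
  suffices H : 0 ≤ ∑ e, f e * w e by linarith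
  rcases hlast with hcard | hpos
  · obtain ⟨c, hc⟩ := (Set.finite_range w).bddBelow
    have := mul_sum_le_sum_mul_of_antitone f w c hw (fun i => hc ⟨i, rfl⟩) hfj
    rwa [hf1, hcard, sub_self, mul_zero] at this
  · simpa using mul_sum_le_sum_mul_of_antitone f w 0 hw hpos hfj

end Sparse

/-! ## Orientations -/

section Orientation

variable {n m k ℓ : ℕ} {G : MultiGraph n m} {D : Orientation n m}

/-- The head of the arc `e`. -/
def head (G : MultiGraph n m) (D : Orientation n m) (e : Fin m) : Fin n :=
  if D.flip e = true then G.src e else G.dst e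

/-- The tail of the arc `e`. -/
def tail (G : MultiGraph n m) (D : Orientation n m) (e : Fin m) : Fin n :=
  if D.flip e = true then G.dst e else G.src e

@[simp] theorem wp_headOf (e : Fin m) (Q : Fin n → ℕ → Prop) :
    wp (headOf G D e) Q ↔ Q (head G D e) 2 := by
  unfold headOf head
  cases h : D.flip e <;> simp [h]

@[simp] theorem wp_tailOf (e : Fin m) (Q : Fin n → ℕ → Prop) :
    wp (tailOf G D e) Q ↔ Q (tail G D e) 2 := by
  unfold tailOf tail
  cases h : D.flip e <;> simp [h]

theorem head_ne_tail (e : Fin m) : head G D e ≠ tail G D e := by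
  unfold head tail
  split_ifs
  · exact G.loopless e
  · exact (G.loopless e).symm

theorem head_mem_and_tail_mem_iff (e : Fin m) (X : Finset (Fin n)) :
    (head G D e ∈ X ∧ tail G D e ∈ X) ↔ (G.src e ∈ X ∧ G.dst e ∈ X) := by
  unfold head tail
  split_ifs
  · rfl
  · exact and_comm

/-- The indegrees that are stored with an orientation are correct. -/
structure Consistent (G : MultiGraph n m) (D : Orientation n m) : Prop where
  nodup : D.arcs.Nodup
  indeg_eq : ∀ x, D.indeg x = ∑ e ∈ D.arcs.toFinset, if head G D e = x then 1 else 0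

theorem Consistent.sum_indeg (h : Consistent G D) (X : Finset (Fin n)) :
    ∑ x ∈ X, D.indeg x = (D.arcs.toFinset.filter fun e => head G D e ∈ X).card := by
  simp only [h.indeg_eq]
  rw [Finset.sum_comm, Finset.card_filter]
  exact Finset.sum_congr rfl fun e _ => by rw [Finset.sum_ite_eq]

theorem inducedEdges_eq_card (X : Finset (Fin n)) : inducedEdges G D.arcs.toFinset X =
    (D.arcs.toFinset.filter fun e => head G D e ∈ X ∧ tail G D e ∈ X).card := by
  simp only [head_mem_and_tail_mem_iff]
  rfl

/-- No arc of `D` enters `X`. -/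
def NoEntering (G : MultiGraph n m) (D : Orientation n m) (X : Finset (Fin n)) : Prop :=
  ∀ e ∈ D.arcs, head G D e ∈ X → tail G D e ∈ X

theorem Consistent.inducedEdges_le (h : Consistent G D) (X : Finset (Fin n)) :
    inducedEdges G D.arcs.toFinset X ≤ ∑ x ∈ X, D.indeg x := by
  rw [h.sum_indeg, inducedEdges_eq_card]
  exact Finset.card_le_card (Finset.monotone_filter_right _ fun e _ he => he.1)

/-- The indegrees of `X` count the arcs with head in `X`; those among them that are not induced are
the entering arcs. -/
theorem Consistent.inducedEdges_eq_iff (h : Consistent G D) (X : Finset (Fin n)) :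
    inducedEdges G D.arcs.toFinset X = ∑ x ∈ X, D.indeg x ↔ NoEntering G D X := by
  rw [h.sum_indeg, inducedEdges_eq_card]
  have hsub : (D.arcs.toFinset.filter fun e => head G D e ∈ X ∧ tail G D e ∈ X) ⊆
      D.arcs.toFinset.filter fun e => head G D e ∈ X :=
    Finset.monotone_filter_right _ fun e _ he => he.1
  constructor
  · intro hcard e he hX
    have := Finset.eq_of_subset_of_card_le hsub hcard.ge
    have hmem : e ∈ D.arcs.toFinset.filter fun e => head G D e ∈ X :=
      Finset.mem_filter.2 ⟨List.mem_toFinset.2 he, hX⟩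
    rw [← this] at hmem
    exact (Finset.mem_filter.1 hmem).2.2
  · intro hno
    congr 1
    refine hsub.antisymm fun e he => ?_
    rw [Finset.mem_filter] at he ⊢
    exact ⟨he.1, he.2, hno e (List.mem_toFinset.1 he.1) he.2⟩

theorem sum_indeg_eq_add {u v : Fin n} (huv : u ≠ v) {X : Finset (Fin n)} (hu : u ∈ X)
    (hv : v ∈ X) : ∑ x ∈ X, D.indeg x =
      D.indeg u + D.indeg v + ∑ x ∈ (X.erase u).erase v, D.indeg x := by
  rw [← Finset.add_sum_erase X _ hu,
    ← Finset.add_sum_erase (X.erase u) _ (Finset.mem_erase.2 ⟨huv.symm, hv⟩), Nat.add_assoc]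

theorem mul_card_eq_add (k : ℕ) {u v : Fin n} (huv : u ≠ v) {X : Finset (Fin n)} (hu : u ∈ X)
    (hv : v ∈ X) : k * X.card = 2 * k + k * ((X.erase u).erase v).card := by
  rw [← Finset.card_erase_add_one hu,
    ← Finset.card_erase_add_one (Finset.mem_erase.2 ⟨huv.symm, hv⟩)]
  ring

/-- A vertex from which a path to `{u, v}` may start. -/
def IsStart (k : ℕ) (D : Orientation n m) (u v w : Fin n) : Prop :=
  w ≠ u ∧ w ≠ v ∧ D.indeg w < k

/-- A set that cannot be reached from the starting vertices. -/
structure Closed (k : ℕ) (G : MultiGraph n m) (D : Orientation n m) (u v : Fin n)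
    (X : Finset (Fin n)) : Prop where
  noEntering : NoEntering G D X
  not_isStart : ∀ w ∈ X, ¬IsStart k D u v w

theorem Consistent.inducedEdges_add_le (h : Consistent G D) (hk : ∀ x, D.indeg x ≤ k)
    {u v : Fin n} (huv : u ≠ v) {X : Finset (Fin n)} (hu : u ∈ X) (hv : v ∈ X) :
    inducedEdges G D.arcs.toFinset X + 2 * k ≤ k * X.card + D.indeg u + D.indeg v := by
  have h1 := h.inducedEdges_le X
  rw [sum_indeg_eq_add huv hu hv] at h1
  have h2 : ∑ x ∈ (X.erase u).erase v, D.indeg x ≤ _ :=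
    Finset.sum_le_card_nsmul ((X.erase u).erase v) D.indeg k fun x _ => hk x
  rw [smul_eq_mul, Nat.mul_comm] at h2
  have h3 := mul_card_eq_add k huv hu hv
  omega

/-- No arc enters, so the edges are counted by the indegrees, and every vertex other than `u` and
`v` has indegree exactly `k`. The total is at least `2k - ℓ + k (|X| - 2)`. -/
theorem Consistent.isBlock_of_closed (hℓ : ℓ < 2 * k) (h : Consistent G D)
    (hk : ∀ x, D.indeg x ≤ k) (hF : IsSparse k ℓ G D.arcs.toFinset) {u v : Fin n} (huv : u ≠ v)
    (hroom : 2 * k - ℓ ≤ D.indeg u + D.indeg v) {X : Finset (Fin n)} (hu : u ∈ X) (hv : v ∈ X)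
    (hX : Closed k G D u v X) : IsBlock k ℓ G D.arcs.toFinset X := by
  refine le_antisymm (hF X) ?_
  rw [(h.inducedEdges_eq_iff X).2 hX.noEntering, sum_indeg_eq_add huv hu hv,
    mul_card_eq_add k huv hu hv]
  have : ∑ x ∈ (X.erase u).erase v, D.indeg x = k * ((X.erase u).erase v).card := by
    rw [Finset.sum_congr rfl (g := fun _ => k), Finset.sum_const, smul_eq_mul, Nat.mul_comm]
    intro x hx
    rw [Finset.mem_erase, Finset.mem_erase] at hx
    by_contra hne
    exact hX.not_isStart x hx.2.2 ⟨hx.2.1, hx.1, lt_of_le_of_ne (hk x) hne⟩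
  omega

/-- The indegrees of `X` add up to at most `2k - ℓ + k (|X| - 2)`, which is the number of edges in
the block. So all estimates are equalities: nothing enters, and all vertices besides `u` and `v` are
saturated. -/
theorem Consistent.closed_of_isBlock (hℓ : ℓ < 2 * k) (h : Consistent G D)
    (hk : ∀ x, D.indeg x ≤ k) {u v : Fin n} (huv : u ≠ v)
    (hroom : D.indeg u + D.indeg v ≤ 2 * k - ℓ) {X : Finset (Fin n)} (hu : u ∈ X) (hv : v ∈ X)
    (hX : IsBlock k ℓ G D.arcs.toFinset X) : Closed k G D u v X := by
  have h1 := h.inducedEdges_le X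
  have h2 : ∑ x ∈ (X.erase u).erase v, D.indeg x ≤ _ :=
    Finset.sum_le_card_nsmul ((X.erase u).erase v) D.indeg k fun x _ => hk x
  rw [smul_eq_mul, Nat.mul_comm] at h2
  have h3 := mul_card_eq_add k huv hu hv
  have h4 := sum_indeg_eq_add (D := D) huv hu hv
  unfold IsBlock at hX
  refine ⟨(h.inducedEdges_eq_iff X).1 (by omega), ?_⟩
  rintro w hw ⟨hwu, hwv, hlt⟩
  have h5 : ∑ x ∈ (X.erase u).erase v, D.indeg x < ∑ x ∈ (X.erase u).erase v, k :=
    Finset.sum_lt_sum (fun x _ => hk x)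
      ⟨w, Finset.mem_erase.2 ⟨hwv, Finset.mem_erase.2 ⟨hwu, hw⟩⟩, hlt⟩
  rw [Finset.sum_const, smul_eq_mul, Nat.mul_comm] at h5
  omega

/-! ## Reversing paths -/

/-- `P` is the list of the arcs of a directed walk from `x` to `y`. -/
def IsWalk (G : MultiGraph n m) (D : Orientation n m) (y : Fin n) : Fin n → List (Fin m) → Prop
  | x, [] => x = y
  | x, e :: P => e ∈ D.arcs ∧ tail G D e = x ∧ IsWalk G D y (head G D e) P

theorem IsWalk.congr {D' : Orientation n m} {y : Fin n} (harcs : D'.arcs = D.arcs) :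
    ∀ {P : List (Fin m)} {x : Fin n}, (∀ e ∈ P, D'.flip e = D.flip e) → IsWalk G D y x P →
      IsWalk G D' y x P
  | [], _, _, h => h
  | e :: P, x, hP, h => by
    have he := hP e List.mem_cons_self
    refine ⟨harcs ▸ h.1, ?_, ?_⟩
    · simpa [tail, he] using h.2.1
    · have := IsWalk.congr harcs (fun e' h' => hP e' (List.mem_cons_of_mem _ h')) h.2.2
      simpa [head, he] using this

theorem IsWalk.subset {y : Fin n} : ∀ {P : List (Fin m)} {x : Fin n}, IsWalk G D y x P →
    P ⊆ D.arcs
  | [], _, _ => List.nil_subset _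
  | _ :: _, _, h => List.cons_subset.2 ⟨h.1, h.2.2.subset⟩

theorem Consistent.reverse (h : Consistent G D) {e : Fin m} (he : e ∈ D.arcs) :
    let D' : Orientation n m := ⟨D.arcs, Function.update D.flip e (!D.flip e),
      Function.update (Function.update D.indeg (head G D e) (D.indeg (head G D e) - 1))
        (tail G D e)
        (Function.update D.indeg (head G D e) (D.indeg (head G D e) - 1) (tail G D e) + 1)⟩
    Consistent G D' ∧ ∀ z, D'.indeg z + (if z = head G D e then 1 else 0) =
      D.indeg z + if z = tail G D e then 1 else 0 := by
  intro D'
  have hne := head_ne_tail (G := G) (D := D) e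
  have hmem : e ∈ D.arcs.toFinset := List.mem_toFinset.2 he
  have hhead : head G D' e = tail G D e := by
    simp only [head, tail, D', Function.update_self]
    cases D.flip e <;> simp
  have hother : ∀ e', e' ≠ e → head G D' e' = head G D e' := fun e' h' => by
    simp only [head, D', Function.update_of_ne h']
  have hsum : ∀ z, (∑ e' ∈ D.arcs.toFinset, if head G D' e' = z then 1 else 0) +
      (if z = head G D e then 1 else 0) = D.indeg z + if z = tail G D e then 1 else 0 := by
    intro z
    rw [h.indeg_eq, ← Finset.add_sum_erase _ _ hmem, ← Finset.add_sum_erase _ _ hmem, hhead,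
      Finset.sum_congr rfl fun e' he' => by rw [hother e' (Finset.ne_of_mem_erase he')]]
    simp only [eq_comm (b := z)]
    omega
  have hpos : 1 ≤ D.indeg (head G D e) := by
    rw [h.indeg_eq, ← Finset.add_sum_erase _ _ hmem]
    simp
  have hindeg : ∀ z, D'.indeg z + (if z = head G D e then 1 else 0) =
      D.indeg z + if z = tail G D e then 1 else 0 := by
    intro z
    simp only [D']
    rw [Function.update_of_ne hne.symm]
    by_cases h1 : z = tail G D e
    · subst h1
      simp [hne.symm]
    · by_cases h2 : z = head G D e
      · subst h2
        simp [h1, hpos]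
      · simp [h1, h2]
  refine ⟨⟨h.nodup, fun z => ?_⟩, hindeg⟩
  have h1 := hsum z
  have h2 := hindeg z
  change D'.indeg z = ∑ e' ∈ D.arcs.toFinset, if head G D' e' = z then 1 else 0
  omega

/-- Reversing an arc moves one unit of indegree from its head to its tail; along the walk this
telescopes to one unit moved from `y` to `x`. The arcs must be distinct so that the rest of the walk
survives the reversal of its first arc. -/
theorem wp_reversePath {y : Fin n} (P : List (Fin m)) : ∀ (D : Orientation n m) (x : Fin n),
    Consistent G D → P.Nodup → IsWalk G D y x P →
    wp (reversePath G P D) fun D' t => Consistent G D' ∧ D'.arcs = D.arcs ∧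
      (∀ z, D'.indeg z + (if z = y then 1 else 0) = D.indeg z + if z = x then 1 else 0) ∧
      t ≤ 14 * P.length + 1 := by
  induction P with
  | nil =>
    intro D x hD _ hP
    obtain rfl : x = y := hP
    simpa [reversePath, forEach] using hD
  | cons e P ih =>
    intro D x hD hnd hP
    obtain ⟨hnot, hnd⟩ := List.nodup_cons.1 hnd
    obtain ⟨he, rfl, hP⟩ := hP
    obtain ⟨h1, h2⟩ := hD.reverse he
    unfold reversePath at ih ⊢
    simp only [forEach, wp_bind, wp_step, wp_tailOf, wp_headOf, wp_read, wp_sub, wp_write, wp_add,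
      wp_bnot, wp_pure]
    refine wp_mono (ih _ (head G D e) h1 hnd ?_) ?_
    · exact IsWalk.congr (D := D) (by rfl) (fun e' he' =>
        Function.update_of_ne (fun h : e' = e => hnot (h ▸ he')) _ _) hP
    · rintro D' t ⟨hD', harcs, hz, ht⟩
      refine ⟨hD', harcs, fun z => ?_, ?_⟩
      · have := hz z
        have := h2 z
        omega
      · simp only [List.length_cons]
        omega

end Orientation

/-! ## Graph traversal -/

section Traversal

variable {n m k ℓ : ℕ} {G : MultiGraph n m} {D : Orientation n m} {u v : Fin n}

theorem sum_length_filter {α : Type} (f : α → Fin n) (l : List α) :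
    ∑ x, (l.filter fun e => f e = x).length = l.length := by
  induction l with
  | nil => simp
  | cons e l ih =>
    have h : ∀ x, ((e :: l).filter fun e => f e = x).length =
        (l.filter fun e => f e = x).length + if f e = x then 1 else 0 := by
      intro x
      by_cases hx : f e = x <;> simp [hx]
    simp only [h]
    rw [Finset.sum_add_distrib, ih]
    simp

theorem wp_outLists : wp (outLists G D) fun out t =>
    (∀ x e, e ∈ out x ↔ e ∈ D.arcs ∧ tail G D e = x) ∧ ∑ x, (out x).length = D.arcs.length ∧
      t = n + 6 * D.arcs.length + 2 := by
  have key : ∀ (l : List (Fin m)) (out : Fin n → List (Fin m)),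
      wp (forEach (fun out e => do
        let x ← tailOf G D e
        let l ← read out x
        let l ← cons e l
        write out x l) l out) fun out' t =>
          (∀ x, out' x = (l.filter fun e => tail G D e = x).reverse ++ out x) ∧
            t = 6 * l.length + 1 := by
    intro l
    induction l with
    | nil => simp [forEach]
    | cons e l ih =>
      intro out
      simp only [forEach, wp_bind, wp_step, wp_tailOf, wp_read, wp_cons, wp_write]
      refine wp_mono (ih _) ?_
      rintro out' t ⟨h, ht⟩
      refine ⟨fun x => ?_, by simp only [List.length_cons]; omega⟩
      rw [h]
      by_cases hx : tail G D e = x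
      · subst hx
        simp
      · simp [hx, Function.update_of_ne (Ne.symm hx)]
  unfold outLists
  simp only [wp_bind, wp_alloc, Fintype.card_fin]
  refine wp_mono (key _ _) ?_
  rintro out t ⟨h, ht⟩
  refine ⟨fun x e => by simp [h], ?_, by omega⟩
  simp only [h, List.append_nil, List.length_reverse]
  exact sum_length_filter _ _

/-- The arcs stored in `parent` form a forest of paths from the starting vertices; `r` is the rank
of a vertex in it. -/
structure IsForest (k : ℕ) (G : MultiGraph n m) (D : Orientation n m) (u v : Fin n)
    (T : Traversal n m) (r : Fin n → ℕ) : Prop where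
  rank_lt : ∀ y, T.reached y = true → r y < (Finset.univ.filter fun z => T.reached z = true).card
  root : ∀ y, T.reached y = true → T.parent y = none → IsStart k D u v y
  reached : ∀ y e, T.parent y = some e → T.reached y = true
  arc : ∀ y e, T.parent y = some e → e ∈ D.arcs ∧ head G D e = y
  tail : ∀ y e, T.parent y = some e → T.reached (tail G D e) = true ∧ r (tail G D e) < r y

/-- The invariant of the traversal; the arcs of `es` may still have to be followed. -/
structure TraversalInv (k : ℕ) (G : MultiGraph n m) (D : Orientation n m) (u v : Fin n)
    (es : List (Fin m)) (T : Traversal n m) : Prop where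
  nodup : T.stack.Nodup
  stack : ∀ x ∈ T.stack, T.reached x = true
  start : ∀ w, IsStart k D u v w → T.reached w = true
  step : ∀ e ∈ D.arcs, T.reached (PebbleGame.tail G D e) = true →
    PebbleGame.tail G D e ∉ T.stack → e ∉ es → T.reached (head G D e) = true
  forest : ∃ r, IsForest k G D u v T r

/-- A completed traversal. -/
structure Traversed (k : ℕ) (G : MultiGraph n m) (D : Orientation n m) (u v : Fin n)
    (T : Traversal n m) : Prop where
  start : ∀ w, IsStart k D u v w → T.reached w = true
  step : ∀ e ∈ D.arcs, T.reached (PebbleGame.tail G D e) = true → T.reached (head G D e) = true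
  forest : ∃ r, IsForest k G D u v T r

/-- Going back along parent arcs from a reached vertex of `X` never leaves `X`, as no arc enters it,
and ends in a starting vertex, which `X` does not contain. With `Traversed.closed`, the unreached
set is the largest closed set. -/
theorem IsForest.not_reached {T : Traversal n m} {r : Fin n → ℕ} (h : IsForest k G D u v T r)
    {X : Finset (Fin n)} (hX : Closed k G D u v X) : ∀ y ∈ X, T.reached y ≠ true := by
  have : ∀ N y, r y < N → y ∈ X → T.reached y ≠ true := by
    intro N
    induction N with
    | zero => exact fun y h => absurd h (Nat.not_lt_zero _)
    | succ N ih =>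
      intro y hy hyX hr
      rcases hp : T.parent y with _ | e
      · exact hX.not_isStart y hyX (h.root y hr hp)
      · obtain ⟨he, rfl⟩ := h.arc y e hp
        obtain ⟨h1, h2⟩ := h.tail _ e hp
        exact ih _ (by omega) (hX.noEntering e he hyX) h1
  exact fun y => this _ y (Nat.lt_succ_self _)

theorem Traversed.closed {T : Traversal n m} (h : Traversed k G D u v T) :
    Closed k G D u v (Finset.univ.filter fun w => T.reached w ≠ true) := by
  refine ⟨fun e he hX => ?_, fun w hw hs => (Finset.mem_filter.1 hw).2 (h.start w hs)⟩
  rw [Finset.mem_filter] at hX ⊢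
  exact ⟨Finset.mem_univ _, fun ht => hX.2 (h.step e he ht)⟩

/-- Reaching a new vertex. -/
theorem TraversalInv.extend {e : Fin m} {es : List (Fin m)} {T : Traversal n m}
    (h : TraversalInv k G D u v (e :: es) T) (he : e ∈ D.arcs)
    (ht : T.reached (PebbleGame.tail G D e) = true) (hy : T.reached (head G D e) ≠ true) :
    TraversalInv k G D u v es ⟨head G D e :: T.stack, Function.update T.reached (head G D e) true,
      Function.update T.parent (head G D e) (some e)⟩ := by
  have hmono : ∀ z, T.reached z = true → Function.update T.reached (head G D e) true z = true := by
    intro z hz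
    by_cases h : z = head G D e
    · rw [h, Function.update_self]
    · rwa [Function.update_of_ne h]
  have hne : ∀ z, T.reached z = true → z ≠ head G D e := fun z hz h => hy (h ▸ hz)
  refine ⟨List.nodup_cons.2 ⟨fun hmem => hy (h.stack _ hmem), h.nodup⟩, ?_,
    fun w hw => hmono w (h.start w hw), ?_, ?_⟩
  · intro x hx
    rcases List.mem_cons.1 hx with rfl | hx
    · exact Function.update_self ..
    · exact hmono x (h.stack x hx)
  · intro e' he' hr hs hes
    obtain ⟨hne', hs⟩ := not_or.1 (fun h => hs (List.mem_cons.2 h))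
    change Function.update T.reached (head G D e) true _ = true at hr
    rw [Function.update_of_ne hne'] at hr
    by_cases heq : e' = e
    · rw [heq]
      exact Function.update_self ..
    · exact hmono _ (h.step e' he' hr hs fun hmem =>
        (List.mem_cons.1 hmem).elim heq hes)
  · obtain ⟨r, hr⟩ := h.forest
    have hcard : (Finset.univ.filter fun z => T.reached z = true).card <
        (Finset.univ.filter fun z => Function.update T.reached (head G D e) true z = true).card := by
      refine Finset.card_lt_card ⟨Finset.monotone_filter_right _ fun z _ => hmono z, fun hsub => ?_⟩
      have := hsub (Finset.mem_filter.2 ⟨Finset.mem_univ (head G D e), Function.update_self ..⟩)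
      exact hy (Finset.mem_filter.1 this).2
    -- The rank is the depth in the forest. It stays below the number of reached vertices because
    -- that number grows by one.
    refine ⟨Function.update r (head G D e) (r (PebbleGame.tail G D e) + 1), ?_, ?_, ?_, ?_, ?_⟩
    · intro z hz
      by_cases hze : z = head G D e
      · rw [hze, Function.update_self]
        exact (Nat.succ_le_of_lt (hr.rank_lt _ ht)).trans_lt hcard
      · rw [Function.update_of_ne hze]
        simp only [Function.update_of_ne hze] at hz
        exact (hr.rank_lt z hz).trans hcard
    · intro z hz hp
      by_cases hze : z = head G D e
      · simp [hze] at hp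
      · simp only [Function.update_of_ne hze] at hz hp
        exact hr.root z hz hp
    · intro z e' hp
      by_cases hze : z = head G D e
      · rw [hze]
        exact Function.update_self ..
      · simp only [Function.update_of_ne hze] at hp
        exact hmono z (hr.reached z e' hp)
    · intro z e' hp
      by_cases hze : z = head G D e
      · subst hze
        simp only [Function.update_self, Option.some.injEq] at hp
        exact hp ▸ ⟨he, rfl⟩
      · simp only [Function.update_of_ne hze] at hp
        exact hr.arc z e' hp
    · intro z e' hp
      by_cases hze : z = head G D e
      · subst hze
        simp only [Function.update_self, Option.some.injEq] at hp
        subst hp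
        rw [Function.update_self, Function.update_of_ne (hne _ ht)]
        exact ⟨hmono _ ht, Nat.lt_succ_self _⟩
      · simp only [Function.update_of_ne hze] at hp
        obtain ⟨h1, h2⟩ := hr.tail z e' hp
        rw [Function.update_of_ne hze, Function.update_of_ne (hne _ h1)]
        exact ⟨hmono _ h1, h2⟩

/-- The vertices that have not been expanded. -/
def unexpanded (T : Traversal n m) : Finset (Fin n) :=
  Finset.univ.filter fun z => T.reached z ≠ true ∨ z ∈ T.stack

theorem wp_expand {x : Fin n} (T : Traversal n m) (l : List (Fin m))
    (hl : ∀ e ∈ l, e ∈ D.arcs ∧ tail G D e = x) (hx : T.reached x = true)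
    (hT : TraversalInv k G D u v l T) :
    wp (forEach (fun (T : Traversal n m) e => do
        let y ← headOf G D e
        if ← read T.reached y then pure T
        else
          let reached ← write T.reached y true
          let parent ← write T.parent y (some e)
          let stack ← cons y T.stack
          pure { stack := stack, reached := reached, parent := parent }) l T) fun T' t =>
      (TraversalInv k G D u v [] T' ∧ unexpanded T' = unexpanded T) ∧ t ≤ 7 * l.length + 1 := by
  refine wp_mono (wp_forEach_le 6 (fun es T' => es ⊆ l ∧ T'.reached x = true ∧
    TraversalInv k G D u v es T' ∧ unexpanded T' = unexpanded T)
    ⟨List.Subset.refl _, hx, hT, rfl⟩ ?_) fun T' t h => ⟨⟨h.1.2.2.1, h.1.2.2.2⟩, h.2⟩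
  rintro e es T' ⟨hsub, hx, hT', hun⟩
  obtain ⟨hel, hsub⟩ := List.cons_subset.1 hsub
  obtain ⟨he, rfl⟩ := hl e hel
  simp only [wp_bind, wp_headOf, wp_read, wp_ite, wp_pure, wp_write, wp_cons]
  constructor
  · intro hr
    refine ⟨⟨hsub, hx, ⟨hT'.nodup, hT'.stack, hT'.start, ?_, hT'.forest⟩, hun⟩, by omega⟩
    intro e' he' h1 h2 h3
    by_cases heq : e' = e
    · exact heq ▸ hr
    · exact hT'.step e' he' h1 h2 fun hmem => (List.mem_cons.1 hmem).elim heq h3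
  · intro hr
    refine ⟨⟨hsub, ?_, hT'.extend he hx hr, ?_⟩, by omega⟩
    · rw [Function.update_of_ne (head_ne_tail e).symm]
      exact hx
    · rw [← hun]
      ext z
      simp only [unexpanded, Finset.mem_filter, Finset.mem_univ, true_and, List.mem_cons]
      by_cases hz : z = head G D e
      · subst hz
        simp [hr]
      · simp [hz]

theorem wp_traverse (k : ℕ) (G : MultiGraph n m) (D : Orientation n m) (u v : Fin n) :
    wp (traverse k G D u v) fun T t =>
      Traversed k G D u v T ∧ t ≤ 20 * (n + D.arcs.length + 1) := by
  unfold traverse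
  simp only [wp_bind, wp_alloc, Fintype.card_fin]
  refine wp_mono wp_outLists ?_
  rintro out t₀ ⟨hout, hlen, rfl⟩
  refine wp_mono (wp_forEach_le 6 (fun ws T => ws.Nodup ∧ T.stack.Nodup ∧
    (∀ w, T.reached w = true ↔ IsStart k D u v w ∧ w ∉ ws) ∧
    (∀ w, w ∈ T.stack ↔ T.reached w = true) ∧ ∀ w, T.parent w = none) ?_ ?_) ?_
  · exact ⟨List.nodup_finRange n, List.nodup_nil, by simp, by simp, by simp⟩
  · rintro w ws T ⟨hnd, hs, hr, hst, hp⟩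
    obtain ⟨hw, hnd⟩ := List.nodup_cons.1 hnd
    have hskip : ¬IsStart k D u v w → ∀ z, T.reached z = true ↔ IsStart k D u v z ∧ z ∉ ws := by
      intro hns z
      rw [hr, List.mem_cons]
      constructor
      · exact fun h => ⟨h.1, fun h' => h.2 (Or.inr h')⟩
      · rintro ⟨h1, h2⟩
        exact ⟨h1, fun h => h.elim (fun h => hns (h ▸ h1)) h2⟩
    simp only [wp_bind, wp_same, wp_read, wp_ite, wp_pure, wp_write, wp_cons, wp_lt,
      decide_eq_true_eq]
    refine ⟨fun h => ⟨⟨hnd, hs, hskip fun h' => h'.1 h, hst, hp⟩, by omega⟩, fun h1 =>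
      ⟨fun h => ⟨⟨hnd, hs, hskip fun h' => h'.2.1 h, hst, hp⟩, by omega⟩, fun h2 =>
      ⟨fun h3 => ?_, fun h => ⟨⟨hnd, hs, hskip fun h' => h h'.2.2, hst, hp⟩, by omega⟩⟩⟩⟩
    have hw' : T.reached w ≠ true := fun h => ((hr w).1 h).2 List.mem_cons_self
    refine ⟨⟨hnd, List.nodup_cons.2 ⟨fun h => hw' ((hst w).1 h), hs⟩, fun z => ?_, fun z => ?_, hp⟩,
      by omega⟩
    · by_cases hz : z = w
      · subst hz
        simp only [Function.update_self, true_iff]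
        exact ⟨⟨h1, h2, h3⟩, hw⟩
      · simp only [Function.update_of_ne hz]
        rw [hr, List.mem_cons]
        simp [hz]
    · by_cases hz : z = w
      · simp [hz]
      · simp [hz, hst]
  · rintro T₀ t₁ ⟨⟨-, hs, hr, hst, hp⟩, ht₁⟩
    rw [List.length_finRange] at ht₁
    refine wp_mono (wp_while (Q := Traversed k G D u v) (TraversalInv k G D u v [])
      -- A vertex pays once for its expansion: at most 7 steps per leaving arc and 5 for the loop
      -- overhead. The final test costs 2. Following an arc does not change `unexpanded`, since a
      -- newly reached vertex enters the stack.
      (fun T => ∑ z ∈ unexpanded T, (5 + 7 * (out z).length) + 2) ?_ ?_) ?_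
    · refine ⟨hs, fun x hx => (hst x).1 hx, fun w hw => (hr w).2 ⟨hw, by simp⟩,
        fun e _ h1 h2 => absurd ((hst _).2 h1) h2, fun _ => 0, fun y hy => ?_,
        fun y hy _ => ((hr y).1 hy).1, ?_, ?_, ?_⟩
      · exact Finset.card_pos.2 ⟨y, Finset.mem_filter.2 ⟨Finset.mem_univ _, hy⟩⟩
      all_goals
        intro y e h
        rw [hp] at h
        cases h
    · rintro ⟨stack, reached, parent⟩ hT
      rcases stack with _ | ⟨x, stack⟩
      · simp only [wp_nonempty]
        refine ⟨fun h => by simp at h, fun _ => ⟨⟨hT.start, fun e he h => ?_, hT.forest⟩, by omega⟩⟩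
        exact hT.step e he h (by simp) (by simp)
      · simp only [wp_nonempty]
        refine ⟨fun _ => ?_, fun h => by simp at h⟩
        simp only [wp_bind, wp_uncons_cons, wp_read]
        have hx : reached x = true := hT.stack x List.mem_cons_self
        obtain ⟨hxs, hnd⟩ := List.nodup_cons.1 hT.nodup
        refine wp_mono (wp_expand (k := k) (u := u) (v := v) (x := x) _ (out x)
          (fun e he => (hout x e).1 he) hx ?_) ?_
        · refine ⟨hnd, fun z hz => hT.stack z (List.mem_cons_of_mem _ hz), hT.start,
            fun e he h1 h2 h3 => ?_, hT.forest.imp fun r h =>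
              ⟨h.rank_lt, h.root, h.reached, h.arc, h.tail⟩⟩
          refine hT.step e he h1 (fun hmem => ?_) (by simp)
          rcases List.mem_cons.1 hmem with h | h
          · exact h3 ((hout x e).2 ⟨he, h⟩)
          · exact h2 h
        · rintro T' t ⟨⟨h1, h2⟩, ht⟩
          refine ⟨h1, ?_⟩
          rw [h2]
          have hmem : x ∈ unexpanded (⟨x :: stack, reached, parent⟩ : Traversal n m) := by
            simp [unexpanded]
          have herase : unexpanded (⟨stack, reached, parent⟩ : Traversal n m) =
              (unexpanded (⟨x :: stack, reached, parent⟩ : Traversal n m)).erase x := by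
            ext z
            by_cases hz : z = x
            · subst hz
              simp [unexpanded, hx, hxs]
            · simp [unexpanded, hz]
          rw [herase, ← Finset.add_sum_erase _ _ hmem]
          omega
    · rintro T t ⟨hT, ht⟩
      refine ⟨hT, ?_⟩
      have h1 : ∑ z ∈ unexpanded T₀, (5 + 7 * (out z).length) ≤ ∑ z, (5 + 7 * (out z).length) :=
        Finset.sum_le_sum_of_subset (Finset.subset_univ _)
      rw [Finset.sum_add_distrib (s := Finset.univ), ← Finset.mul_sum, hlen, Finset.sum_const, Finset.card_univ,
        Fintype.card_fin, smul_eq_mul] at h1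
      omega

/-! ## Finding and reversing a path -/

theorem wp_tracePath {T : Traversal n m} {r : Fin n → ℕ} (hT : IsForest k G D u v T r) {y : Fin n}
    (hy : T.reached y = true) : wp (tracePath G D T y) fun P t =>
      (∃ x, IsStart k D u v x ∧ IsWalk G D y x P ∧ P.Nodup) ∧ t ≤ 7 * n := by
  unfold tracePath
  simp only [wp_bind, wp_pure, Nat.add_zero]
  refine wp_mono (wp_while (Q := fun s => IsStart k D u v s.1 ∧ IsWalk G D y s.1 s.2 ∧ s.2.Nodup)
    (fun s : Fin n × List (Fin m) => T.reached s.1 = true ∧ IsWalk G D y s.1 s.2 ∧ s.2.Nodup ∧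
      -- The rank drops at each step backwards, which makes the arcs of the path distinct and bounds
      -- its length.
      ∀ e ∈ s.2, r s.1 < r (head G D e)) (fun s => 7 * r s.1 + 3) ?_ ?_) ?_
  · exact ⟨hy, rfl, List.nodup_nil, by simp⟩
  · rintro ⟨z, P⟩ ⟨hz, hw, hnd, hr⟩
    simp only [wp_bind, wp_read, wp_isSome]
    rcases hp : T.parent z with _ | e
    · simp only [Option.isSome_none, Bool.false_eq_true, false_implies, true_and, forall_const]
      exact ⟨⟨hT.root z hz hp, hw, hnd⟩, by omega⟩
    · simp only [Option.isSome_some, forall_const, wp_bind, wp_tailOf, wp_cons, wp_pure]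
      refine ⟨?_, fun h => by simp at h⟩
      obtain ⟨he, rfl⟩ := hT.arc z e hp
      obtain ⟨h1, h2⟩ := hT.tail _ e hp
      refine ⟨⟨h1, ⟨he, rfl, hw⟩, List.nodup_cons.2 ⟨fun hmem => lt_irrefl _ (hr e hmem), hnd⟩, ?_⟩,
        by omega⟩
      intro e' he'
      rcases List.mem_cons.1 he' with rfl | he'
      · exact h2
      · exact h2.trans (hr e' he')
  · rintro ⟨z, P⟩ t ⟨h, ht⟩
    refine ⟨⟨z, h⟩, ht.trans ?_⟩
    have h1 := hT.rank_lt y hy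
    have h2 := Finset.card_le_univ (Finset.univ.filter fun z => T.reached z = true)
    rw [Fintype.card_fin] at h2
    change 7 * r y + 3 ≤ 7 * n
    omega

theorem wp_smallIndeg (Q : Bool → ℕ → Prop) : wp (smallIndeg k ℓ D u v) Q ↔
    Q (decide (D.indeg u + D.indeg v < 2 * k - ℓ)) 6 := by
  unfold smallIndeg
  simp only [wp_bind, wp_read, wp_add, wp_sub, wp_lt, Nat.two_mul]

/-- If the traversal reached neither `u` nor `v`, the unreached set would be closed and hence a
block containing both. -/
theorem wp_findPath (hℓ : ℓ < 2 * k) (h : Consistent G D) (hk : ∀ x, D.indeg x ≤ k)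
    (hF : IsSparse k ℓ G D.arcs.toFinset) (huv : u ≠ v)
    (hroom : 2 * k - ℓ ≤ D.indeg u + D.indeg v)
    (hX : ¬∃ X, IsBlock k ℓ G D.arcs.toFinset X ∧ u ∈ X ∧ v ∈ X) :
    wp (findPath k G D u v) fun P t =>
      (∃ x y, IsStart k D u v x ∧ (y = u ∨ y = v) ∧ IsWalk G D y x P ∧ P.Nodup) ∧
        t ≤ 27 * (n + D.arcs.length + 1) := by
  unfold findPath
  simp only [wp_bind, wp_read, wp_ite]
  refine wp_mono (wp_traverse k G D u v) ?_
  rintro T t ⟨hT, ht⟩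
  obtain ⟨r, hr⟩ := hT.forest
  refine ⟨fun hu => wp_mono (wp_tracePath hr hu) ?_, fun hu =>
    ⟨fun hv => wp_mono (wp_tracePath hr hv) ?_, fun hv => ?_⟩⟩
  · rintro P t' ⟨⟨x, hx⟩, ht'⟩
    exact ⟨⟨x, u, hx.1, Or.inl rfl, hx.2⟩, by omega⟩
  · rintro P t' ⟨⟨x, hx⟩, ht'⟩
    exact ⟨⟨x, v, hx.1, Or.inr rfl, hx.2⟩, by omega⟩
  · refine absurd ⟨_, h.isBlock_of_closed hℓ hk hF huv hroom ?_ ?_ hT.closed, ?_, ?_⟩ hX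
    · simpa using hu
    · simpa using hv
    · simpa using hu
    · simpa using hv

/-- A reversal takes one unit from `{u, v}` and gives it to a vertex of indegree below `k`, so the
bound `k` persists. The edge set is unchanged, hence there is still no block around `u` and `v` and
the next search succeeds too. -/
theorem wp_makeRoom (hℓ : ℓ < 2 * k) (h : Consistent G D) (hk : ∀ x, D.indeg x ≤ k)
    (hF : IsSparse k ℓ G D.arcs.toFinset) (huv : u ≠ v)
    (hX : ¬∃ X, IsBlock k ℓ G D.arcs.toFinset X ∧ u ∈ X ∧ v ∈ X) :
    wp (makeRoom k ℓ G D u v) fun D' t =>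
      (Consistent G D' ∧ D'.arcs = D.arcs ∧ (∀ x, D'.indeg x ≤ k) ∧
        D'.indeg u + D'.indeg v < 2 * k - ℓ) ∧
        t ≤ 58 * (ℓ + 1) * (n + D.arcs.length + 1) := by
  unfold makeRoom
  obtain ⟨N, hN⟩ : ∃ N, N = n + D.arcs.length + 1 := ⟨_, rfl⟩
  rw [← hN]
  refine wp_mono (wp_while (Q := fun D' : Orientation n m => Consistent G D' ∧ D'.arcs = D.arcs ∧
    (∀ x, D'.indeg x ≤ k) ∧ D'.indeg u + D'.indeg v < 2 * k - ℓ)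
    (fun D' : Orientation n m => Consistent G D' ∧ D'.arcs = D.arcs ∧ ∀ x, D'.indeg x ≤ k)
    -- The last factor is the number of reversals still needed, at most `ℓ + 1` as `ϱ(u) + ϱ(v) ≤
    -- 2k`. One round costs at most `50 N`, and the final test 8 steps.
    (fun D' => 50 * N * (D'.indeg u + D'.indeg v + 1 - (2 * k - ℓ)) + 8)
    ⟨h, rfl, hk⟩ ?_) ?_
  · rintro D' ⟨hD', harcs, hk'⟩
    simp only [wp_bind, wp_smallIndeg, wp_bnot, Bool.not_eq_true', Bool.not_eq_false',
      decide_eq_false_iff_not, decide_eq_true_eq, Nat.not_lt]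
    refine ⟨fun hroom => ?_, fun hroom => ⟨⟨hD', harcs, hk', hroom⟩, by omega⟩⟩
    rw [← harcs] at hF hX
    refine wp_mono (wp_findPath hℓ hD' hk' hF huv hroom hX) ?_
    rintro P t ⟨⟨x, y, hx, hy, hw, hnd⟩, ht⟩
    have hlen : P.length ≤ D.arcs.length := harcs ▸ (hnd.subperm hw.subset).length_le
    refine wp_mono (wp_reversePath P D' x hD' hnd hw) ?_
    rintro D'' t' ⟨hD'', harcs', hz, ht'⟩
    rw [harcs] at harcs' ht
    have hxy : x ≠ y := fun h => hy.elim (fun h' => hx.1 (h.trans h')) fun h' => hx.2.1 (h.trans h')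
    refine ⟨⟨hD'', harcs', fun z => ?_⟩, ?_⟩
    · have h1 := hz z
      by_cases hzx : z = x
      · subst hzx
        have := hx.2.2
        simp only [if_neg hxy, if_true] at h1
        omega
      · rw [if_neg hzx] at h1
        have := hk' z
        omega
    · have hdec : D''.indeg u + D''.indeg v + 1 = D'.indeg u + D'.indeg v := by
        have h1 := hz u
        have h2 := hz v
        rw [if_neg hx.1.symm] at h1
        rw [if_neg hx.2.1.symm] at h2
        rcases hy with rfl | rfl
        · rw [if_pos rfl] at h1
          rw [if_neg huv.symm] at h2
          omega
        · rw [if_neg huv] at h1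
          rw [if_pos rfl] at h2
          omega
      have h1 : D'.indeg u + D'.indeg v + 1 - (2 * k - ℓ) =
          D''.indeg u + D''.indeg v + 1 - (2 * k - ℓ) + 1 := by omega
      rw [h1, Nat.mul_succ]
      omega
  · rintro D' t ⟨hD', ht⟩
    refine ⟨hD', ht.trans ?_⟩
    have h1 : D.indeg u + D.indeg v + 1 - (2 * k - ℓ) ≤ ℓ + 1 := by
      have := hk u
      have := hk v
      omega
    have h2 := Nat.mul_le_mul_left (50 * N) h1
    have h3 : 1 ≤ (ℓ + 1) * N := Nat.mul_pos (Nat.succ_pos _) (by omega)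
    calc _ ≤ 50 * N * (ℓ + 1) + 8 * ((ℓ + 1) * N) := by omega
      _ = _ := by ring

/-- If `ϱ(u) + ϱ(v) < 2k - ℓ`, no set containing `u` and `v` has enough edges for a block. Otherwise
equality holds, blocks and closed sets containing `u` and `v` coincide, and the unreached set is the
largest closed set. -/
theorem wp_findComponent (hℓ : ℓ < 2 * k) (h : Consistent G D) (hk : ∀ x, D.indeg x ≤ k)
    (hF : IsSparse k ℓ G D.arcs.toFinset) (huv : u ≠ v)
    (hroom : D.indeg u + D.indeg v ≤ 2 * k - ℓ) :
    wp (findComponent k ℓ G D u v) fun C t =>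
      ((C = [] ∧ ¬∃ X, IsBlock k ℓ G D.arcs.toFinset X ∧ u ∈ X ∧ v ∈ X) ∨
        C.Nodup ∧ IsBlock k ℓ G D.arcs.toFinset C.toFinset ∧ u ∈ C ∧ v ∈ C ∧
          ∀ X, IsBlock k ℓ G D.arcs.toFinset X → u ∈ X → v ∈ X → X ⊆ C.toFinset) ∧
        t ≤ 30 * (n + D.arcs.length + 1) := by
  unfold findComponent
  simp only [wp_bind, wp_smallIndeg, wp_ite, wp_pure, wp_read, decide_eq_true_eq, Nat.not_lt]
  refine ⟨fun hlt => ⟨Or.inl ⟨by trivial, ?_⟩, by omega⟩, fun hge => ?_⟩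
  · rintro ⟨X, hX, hu, hv⟩
    have h1 := h.inducedEdges_add_le hk huv hu hv
    have h2 := mul_card_eq_add k huv hu hv
    unfold IsBlock at hX
    omega
  · refine wp_mono (wp_traverse k G D u v) ?_
    rintro T t ⟨hT, ht⟩
    obtain ⟨r, hr⟩ := hT.forest
    have hblock : ∀ X, IsBlock k ℓ G D.arcs.toFinset X → u ∈ X → v ∈ X → ∀ y ∈ X,
        T.reached y ≠ true := fun X hX hu hv =>
      hr.not_reached (h.closed_of_isBlock hℓ hk huv hroom hu hv hX)
    refine ⟨fun hu => ⟨Or.inl ⟨by trivial, fun ⟨X, hX, h1, h2⟩ => hblock X hX h1 h2 u h1 hu⟩, by omega⟩,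
      fun hu => ⟨fun hv => ⟨Or.inl ⟨by trivial, fun ⟨X, hX, h1, h2⟩ => hblock X hX h1 h2 v h2 hv⟩,
        by omega⟩, fun hv => ?_⟩⟩
    refine wp_mono (wp_forEach_le 2 (fun ws C => ws.Nodup ∧ C.Nodup ∧
      ∀ w, w ∈ C ↔ T.reached w ≠ true ∧ w ∉ ws) ?_ ?_) ?_
    · exact ⟨List.nodup_finRange n, List.nodup_nil, by simp⟩
    · rintro w ws C ⟨hnd, hC, hmem⟩
      obtain ⟨hw, hnd⟩ := List.nodup_cons.1 hnd
      simp only [wp_bind, wp_read, wp_ite, wp_pure, wp_cons]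
      refine ⟨fun hr => ⟨⟨hnd, hC, fun z => ?_⟩, by omega⟩, fun hr => ⟨⟨hnd,
        List.nodup_cons.2 ⟨fun h => ((hmem w).1 h).2 List.mem_cons_self, hC⟩, fun z => ?_⟩,
        by omega⟩⟩
      · rw [hmem, List.mem_cons]
        constructor
        · exact fun h => ⟨h.1, fun h' => h.2 (Or.inr h')⟩
        · rintro ⟨h1, h2⟩
          exact ⟨h1, fun h => h.elim (fun h => h1 (h ▸ hr)) h2⟩
      · rw [List.mem_cons, hmem, List.mem_cons]
        by_cases hz : z = w
        · subst hz
          simp [hr, hw]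
        · simp [hz]
    · rintro C t' ⟨⟨-, hC, hmem⟩, ht'⟩
      rw [List.length_finRange] at ht'
      have hCeq : C.toFinset = Finset.univ.filter fun w => T.reached w ≠ true := by
        ext z
        simp [hmem]
      have huC : u ∈ C := (hmem u).2 ⟨hu, by simp⟩
      have hvC : v ∈ C := (hmem v).2 ⟨hv, by simp⟩
      refine ⟨Or.inr ⟨hC, ?_, huC, hvC, fun X hX h1 h2 y hy => ?_⟩, by omega⟩
      · refine h.isBlock_of_closed hℓ hk hF huv hge (List.mem_toFinset.2 huC)
          (List.mem_toFinset.2 hvC) ?_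
        rw [hCeq]
        exact hT.closed
      · exact List.mem_toFinset.2 ((hmem y).2 ⟨hblock X hX h1 h2 y hy, by simp⟩)

end Traversal

/-! ## Updating the component data -/

section Update

variable {n : ℕ}

theorem wp_charVec (l : List (Fin n)) : wp (charVec l) fun I t =>
    (∀ w, I w = true ↔ w ∈ l) ∧ t = n + 2 * l.length + 2 := by
  have key : ∀ (l : List (Fin n)) (I : Fin n → Bool),
      wp (forEach (fun I w => write I w true) l I) fun I' t =>
        (∀ w, I' w = true ↔ w ∈ l ∨ I w = true) ∧ t = 2 * l.length + 1 := by
    intro l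
    induction l with
    | nil => simp [forEach]
    | cons x l ih =>
      intro I
      simp only [forEach, wp_bind, wp_step, wp_write]
      refine wp_mono (ih _) ?_
      rintro I' t ⟨h, rfl⟩
      refine ⟨fun w => ?_, by simp only [List.length_cons]; omega⟩
      rw [h, List.mem_cons]
      by_cases hw : w = x <;> simp [hw]
  unfold charVec
  simp only [wp_bind, wp_alloc, Fintype.card_fin]
  refine wp_mono (key l _) ?_
  rintro I t ⟨h, rfl⟩
  exact ⟨fun w => by simp [h], by omega⟩

theorem wp_listDiff {l : List (Fin n)} (hl : l.Nodup) (I : Fin n → Bool) :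
    wp (listDiff l I) fun A t => ((∀ w, w ∈ A ↔ w ∈ l ∧ I w ≠ true) ∧ A.Nodup) ∧
      t ≤ 3 * l.length + 1 := by
  unfold listDiff
  refine wp_mono (wp_forEach_le 2 (fun xs A => xs.Nodup ∧ xs ⊆ l ∧
    (∀ w, w ∈ A ↔ (w ∈ l ∧ w ∉ xs) ∧ I w ≠ true) ∧ A.Nodup)
    ⟨hl, List.Subset.refl _, by simp, List.nodup_nil⟩ ?_) ?_
  · rintro x xs A ⟨hnd, hsub, hA, hAnd⟩
    obtain ⟨hx, hnd⟩ := List.nodup_cons.1 hnd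
    obtain ⟨hxl, hsub⟩ := List.cons_subset.1 hsub
    simp only [wp_bind, wp_read, wp_ite, wp_pure, wp_cons]
    refine ⟨fun hI => ⟨⟨hnd, hsub, fun w => ?_, hAnd⟩, by omega⟩, fun hI => ⟨⟨hnd, hsub, fun w => ?_,
      List.nodup_cons.2 ⟨fun h => ((hA x).1 h).1.2 List.mem_cons_self, hAnd⟩⟩, by omega⟩⟩
    · rw [hA, List.mem_cons]
      by_cases hw : w = x
      · subst hw
        simp [hI]
      · simp [hw]
    · rw [List.mem_cons, hA, List.mem_cons]
      by_cases hw : w = x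
      · subst hw
        simp [hI, hx, hxl]
      · simp [hw]
  · rintro A t ⟨⟨-, -, hA, hAnd⟩, ht⟩
    exact ⟨⟨fun w => by simp [hA], hAnd⟩, ht⟩

/-- The entries of `M` that are equal to `1`. -/
def ones (M : Fin n × Fin n → Bool) : Finset (Fin n × Fin n) :=
  Finset.univ.filter fun p => M p = true

@[simp] theorem mem_ones {M : Fin n × Fin n → Bool} {p : Fin n × Fin n} :
    p ∈ ones M ↔ M p = true := by
  simp [ones]

/-- `K'` is obtained from `K` by `w` writes, which set the entries of `S` to `1`. -/
structure Marked (K K' : CompData n) (S : Finset (Fin n × Fin n)) (w : ℕ) : Prop where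
  comps : K'.comps = K.comps
  merged : K'.merged = K.merged
  ones_eq : ones K'.M = ones K.M ∪ S
  count : (ones K'.M).card + K'.redundant = (ones K.M).card + K.redundant + w

theorem Marked.refl (K : CompData n) : Marked K K ∅ 0 :=
  ⟨rfl, rfl, by simp, rfl⟩

theorem Marked.trans {K K' K'' : CompData n} {S S' S'' : Finset (Fin n × Fin n)} {w w' : ℕ}
    (h : Marked K K' S w) (h' : Marked K' K'' S' w') (hS : S'' = S ∪ S') :
    Marked K K'' S'' (w + w') := by
  refine ⟨h'.comps.trans h.comps, h'.merged.trans h.merged, ?_, ?_⟩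
  · rw [h'.ones_eq, h.ones_eq, Finset.union_assoc, hS]
  · have := h.count
    have := h'.count
    omega

/-- A number of writes equal to `S.card` means that each entry of `S` was written once, so the
redundant writes are the entries of `S` that were already ones. -/
theorem Marked.redundant_eq {K K' : CompData n} {S : Finset (Fin n × Fin n)}
    (h : Marked K K' S S.card) : K'.redundant = K.redundant + (ones K.M ∩ S).card := by
  have h1 := h.count
  have h2 := Finset.card_union_add_card_inter (ones K.M) S
  rw [h.ones_eq] at h1
  omega

theorem wp_setBit (K : CompData n) (u v : Fin n) :
    wp (setBit K u v) fun K' t => Marked K K' {(u, v)} 1 ∧ t = 1 := by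
  unfold setBit
  simp only [wp_bind, wp_write, wp_pure, and_true]
  have hones : ones (Function.update K.M (u, v) true) = insert (u, v) (ones K.M) := by
    ext p
    by_cases hp : p = (u, v)
    · simp [hp]
    · simp [hp]
  refine ⟨rfl, rfl, ?_, ?_⟩
  · rw [hones, Finset.union_comm]
    rfl
  · simp only [hones]
    split_ifs with h
    · rw [Finset.insert_eq_of_mem (mem_ones.2 h)]
      omega
    · rw [Finset.card_insert_of_notMem (by simpa using h)]
      omega

theorem wp_markBoth (A B : List (Fin n)) : ∀ K : CompData n, wp (markBoth A B K) fun K' t =>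
    Marked K K' (A.toFinset ×ˢ B.toFinset ∪ B.toFinset ×ˢ A.toFinset)
      (2 * (A.length * B.length)) ∧ t = A.length * (3 * B.length + 2) + 1 := by
  have inner : ∀ (u : Fin n) (B : List (Fin n)) (K : CompData n),
      wp (forEach (fun K v => do
        let K ← setBit K v u
        setBit K u v) B K) fun K' t =>
        Marked K K' ({u} ×ˢ B.toFinset ∪ B.toFinset ×ˢ {u}) (2 * B.length) ∧
          t = 3 * B.length + 1 := by
    intro u B
    induction B with
    | nil => simpa [forEach] using fun K => Marked.refl K
    | cons v B ih =>
      intro K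
      simp only [forEach, wp_bind, wp_step]
      refine wp_mono (wp_setBit K v u) ?_
      rintro K₁ t₁ ⟨h1, rfl⟩
      refine wp_mono (wp_setBit K₁ u v) ?_
      rintro K₂ t₂ ⟨h2, rfl⟩
      refine wp_mono (ih K₂) ?_
      rintro K₃ t₃ ⟨h3, rfl⟩
      refine ⟨?_, by simp only [List.length_cons]; omega⟩
      have := (h1.trans h2 rfl).trans h3 (S'' := {u} ×ˢ (v :: B).toFinset ∪
        (v :: B).toFinset ×ˢ {u}) (by
          ext ⟨a, b⟩
          simp only [List.toFinset_cons, Finset.mem_union, Finset.mem_product, Finset.mem_singleton,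
            Finset.mem_insert, Prod.mk.injEq]
          tauto)
      rwa [List.length_cons, show 2 * (B.length + 1) = 1 + 1 + 2 * B.length by omega]
  unfold markBoth
  induction A with
  | nil => simpa [forEach] using fun K => Marked.refl K
  | cons u A ih =>
    intro K
    simp only [forEach, wp_bind, wp_step]
    refine wp_mono (inner u B K) ?_
    rintro K₁ t₁ ⟨h1, rfl⟩
    refine wp_mono (ih K₁) ?_
    rintro K₂ t₂ ⟨h2, rfl⟩
    refine ⟨?_, by simp only [List.length_cons]; ring⟩
    have := h1.trans h2 (S'' := (u :: A).toFinset ×ˢ B.toFinset ∪ B.toFinset ×ˢ (u :: A).toFinset)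
      (by
        ext ⟨a, b⟩
        simp only [List.toFinset_cons, Finset.mem_union, Finset.mem_product, Finset.mem_singleton,
          Finset.mem_insert]
        tauto)
    rwa [List.length_cons, show 2 * ((A.length + 1) * B.length) =
      2 * B.length + 2 * (A.length * B.length) by ring]

theorem wp_markOnce (A B : List (Fin n)) : ∀ K : CompData n, wp (markOnce A B K) fun K' t =>
    Marked K K' (A.toFinset ×ˢ B.toFinset) (A.length * B.length) ∧
      t = A.length * (2 * B.length + 2) + 1 := by
  have inner : ∀ (u : Fin n) (B : List (Fin n)) (K : CompData n),
      wp (forEach (fun K v => setBit K u v) B K) fun K' t =>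
        Marked K K' ({u} ×ˢ B.toFinset) B.length ∧ t = 2 * B.length + 1 := by
    intro u B
    induction B with
    | nil => simpa [forEach] using fun K => Marked.refl K
    | cons v B ih =>
      intro K
      simp only [forEach, wp_bind, wp_step]
      refine wp_mono (wp_setBit K u v) ?_
      rintro K₁ t₁ ⟨h1, rfl⟩
      refine wp_mono (ih K₁) ?_
      rintro K₂ t₂ ⟨h2, rfl⟩
      refine ⟨?_, by simp only [List.length_cons]; omega⟩
      have := h1.trans h2 (S'' := {u} ×ˢ (v :: B).toFinset) (by
        ext ⟨a, b⟩
        simp only [List.toFinset_cons, Finset.mem_union, Finset.mem_product, Finset.mem_singleton,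
          Finset.mem_insert, Prod.mk.injEq]
        tauto)
      rwa [List.length_cons, Nat.add_comm B.length]
  unfold markOnce
  induction A with
  | nil => simpa [forEach] using fun K => Marked.refl K
  | cons u A ih =>
    intro K
    simp only [forEach, wp_bind, wp_step]
    refine wp_mono (inner u B K) ?_
    rintro K₁ t₁ ⟨h1, rfl⟩
    refine wp_mono (ih K₁) ?_
    rintro K₂ t₂ ⟨h2, rfl⟩
    refine ⟨?_, by simp only [List.length_cons]; ring⟩
    have := h1.trans h2 (S'' := (u :: A).toFinset ×ˢ B.toFinset) (by
        ext ⟨a, b⟩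
        simp only [List.toFinset_cons, Finset.mem_union, Finset.mem_product, Finset.mem_singleton,
          Finset.mem_insert]
        tauto)
    rwa [List.length_cons, show (A.length + 1) * B.length = B.length + A.length * B.length by ring]

/-- The first two entries are distinct because the list has no duplicates, so once both lie in `C`
the hypothesis on pairs yields the inclusion. -/
theorem wp_subsetTest {I : Fin n → Bool} {C X : List (Fin n)} (hI : ∀ w, I w = true ↔ w ∈ C)
    (hX : X.Nodup) (h : ∀ a ∈ X, ∀ b ∈ X, a ≠ b → a ∈ C → b ∈ C → X ⊆ C) :
    wp (subsetTest I X) fun b t => (b = true ↔ X ⊆ C) ∧ t ≤ 4 := by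
  unfold subsetTest
  rcases X with _ | ⟨x, _ | ⟨y, X⟩⟩
  · simp
  · simp only [wp_bind, wp_uncons_cons, wp_read, wp_ite, wp_uncons_nil, wp_pure]
    refine ⟨fun hx => ⟨by simpa using (hI x).1 hx, by omega⟩, fun hx => ⟨?_, by omega⟩⟩
    simpa [hI] using hx
  · simp only [wp_bind, wp_uncons_cons, wp_read, wp_ite, wp_pure]
    refine ⟨fun hx => ⟨⟨fun hy => ?_, fun hsub => (hI y).2 (hsub (by simp))⟩, by omega⟩,
      fun hx => ⟨⟨fun hf => (by cases hf), fun hsub => absurd ((hI x).2 (hsub (by simp))) hx⟩,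
        by omega⟩⟩
    refine h x (by simp) y (by simp) ?_ ((hI x).1 hx) ((hI y).1 hy)
    rintro rfl
    simp at hX

/-- The component data before a call of `updateComponents C`: the matrix and the list agree, and
entries of the list that share two elements with `C` are contained in `C`. -/
structure Updatable (K : CompData n) (C : List (Fin n)) : Prop where
  nodup : C.Nodup
  comps_nodup : ∀ X ∈ K.comps, X.Nodup
  subset : ∀ X ∈ K.comps, ∀ a ∈ X, ∀ b ∈ X, a ≠ b → a ∈ C → b ∈ C → X ⊆ C
  M_iff : ∀ a b, K.M (a, b) = true ↔ ∃ X ∈ K.comps, a ∈ X ∧ b ∈ X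

theorem nodup_length_le {l : List (Fin n)} (hl : l.Nodup) : l.length ≤ n := by
  simpa using hl.length_le_card

/-- The invariant of the loop of `updateComponents`; `xs` are the components still to be treated
and `W` contains the vertices that lie in two of the merged components. -/
structure UpdateInv (K : CompData n) (C : List (Fin n)) (W : Finset (Fin n))
    (xs : List (List (Fin n))) (s : UpdateState n) (t : ℕ) : Prop where
  ex : ∃ ys, K.comps = ys ++ xs ∧ s.log = ys.filter (fun X => decide (X ⊆ C)) ∧
    s.newComps = (ys.filter (fun X => !decide (X ⊆ C))).reverse ++ [C] ∧
    t + 2 * ((ones K.M).card + K.redundant) ≤ 6 * ys.length + 30 * (n + 1) * s.log.length +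
      2 * ((ones s.data.M).card + s.data.redundant)
  merged : s.data.merged = K.merged
  nodup : s.U.Nodup
  mem_U : ∀ w, w ∈ s.U ↔ ∃ X ∈ s.log, w ∈ X
  inU : ∀ w, s.inU w = true ↔ w ∈ s.U
  ones_eq : ones s.data.M = ones K.M ∪ s.U.toFinset ×ˢ s.U.toFinset
  redundant : s.data.redundant ≤ K.redundant + (W ∩ s.U.toFinset).card ^ 2

theorem UpdateInv.mem_log {K : CompData n} {C : List (Fin n)} {W : Finset (Fin n)}
    {xs : List (List (Fin n))} {s : UpdateState n} {t : ℕ} (hs : UpdateInv K C W xs s t) :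
    ∀ Y ∈ s.log, Y ∈ K.comps ∧ Y ⊆ C := by
  obtain ⟨ys, hys, hlog, -⟩ := hs.ex
  intro Y hY
  rw [hlog, List.mem_filter, decide_eq_true_eq] at hY
  exact ⟨hys ▸ List.mem_append_left _ hY.1, hY.2⟩

/-- Bound on the redundant writes when `X` is merged into `U`. -/
theorem UpdateInv.card_inter_le {K : CompData n} {C : List (Fin n)} {W : Finset (Fin n)}
    {X : List (Fin n)} {xs : List (List (Fin n))} {s : UpdateState n} {t : ℕ}
    (hs : UpdateInv K C W (X :: xs) s t) (h : Updatable K C)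
    (hW : ∀ X ∈ K.comps, ∀ Y ∈ K.comps, X ⊆ C → Y ⊆ C → X ≠ Y → ∀ a ∈ X, a ∈ Y → a ∈ W)
    (hXC : X ⊆ C) {A B : Finset (Fin n)} (hA : ∀ w, w ∈ A ↔ w ∈ s.U ∧ w ∉ X)
    (hB : ∀ w, w ∈ B ↔ w ∈ X ∧ w ∉ s.U) :
    (ones s.data.M ∩ (A ×ˢ B ∪ B ×ˢ A)).card ≤
      2 * ((W ∩ s.U.toFinset).card * (W ∩ B).card) := by
  have hX : X ∈ K.comps := by
    obtain ⟨ys, hys, -⟩ := hs.ex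
    exact hys ▸ by simp
  -- The component `Y` that caused the earlier one at `(a, b)` shares two vertices with `C`, hence
  -- lies in `C`. It differs from the merged `Z` containing `a`, because `b ∉ U`, and from `X`,
  -- because `a ∉ X`. So `a` and `b` each lie in two of the sets contained in `C`.
  have hpair : ∀ a ∈ A, ∀ b ∈ B, (∃ Y ∈ K.comps, a ∈ Y ∧ b ∈ Y) →
      a ∈ W ∩ s.U.toFinset ∧ b ∈ W ∩ B := by
    rintro a ha b hb ⟨Y, hY, haY, hbY⟩
    obtain ⟨haU, haX⟩ := (hA a).1 ha
    obtain ⟨hbX, hbU⟩ := (hB b).1 hb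
    obtain ⟨Z, hZ, haZ⟩ := (hs.mem_U a).1 haU
    have hZC := hs.mem_log Z hZ
    have hYC := h.subset Y hY a haY b hbY (fun h => haX (h ▸ hbX)) (hZC.2 haZ) (hXC hbX)
    refine ⟨Finset.mem_inter.2 ⟨hW Z hZC.1 Y hY hZC.2 hYC ?_ a haZ haY, List.mem_toFinset.2 haU⟩,
      Finset.mem_inter.2 ⟨hW X hX Y hY hXC hYC ?_ b hbX hbY, hb⟩⟩
    · rintro rfl
      exact hbU ((hs.mem_U b).2 ⟨Z, hZ, hbY⟩)
    · rintro rfl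
      exact haX haY
  have hsub : ones s.data.M ∩ (A ×ˢ B ∪ B ×ˢ A) ⊆
      (W ∩ s.U.toFinset) ×ˢ (W ∩ B) ∪ (W ∩ B) ×ˢ (W ∩ s.U.toFinset) := by
    rintro ⟨a, b⟩ hab
    rw [hs.ones_eq, Finset.mem_inter, Finset.mem_union, Finset.mem_union, mem_ones, h.M_iff,
      Finset.mem_product, Finset.mem_product, Finset.mem_product, List.mem_toFinset,
      List.mem_toFinset] at hab
    rw [Finset.mem_union, Finset.mem_product, Finset.mem_product]
    obtain ⟨h1, h2 | h2⟩ := hab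
    · rcases h1 with h1 | h1
      · exact Or.inl (hpair a h2.1 b h2.2 h1)
      · exact absurd h1.2 ((hB b).1 h2.2).2
    · rcases h1 with ⟨Y, hY, ha, hb⟩ | h1
      · exact Or.inr (hpair b h2.2 a h2.1 ⟨Y, hY, hb, ha⟩).symm
      · exact absurd h1.1 ((hB a).1 h2.1).2
  refine (Finset.card_le_card hsub).trans ((Finset.card_union_le _ _).trans ?_)
  rw [Finset.card_product, Finset.card_product]
  exact le_of_eq (by ring)

/-- A kept set costs at most 6 steps; a merged one costs O(n) plus its writes, at most 2 steps per
write. Every write raises either the number of ones or `redundant` by one, which lets the difference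
of their sums pay. -/
theorem wp_updateStep {K : CompData n} {C : List (Fin n)} {W : Finset (Fin n)}
    (h : Updatable K C)
    (hW : ∀ X ∈ K.comps, ∀ Y ∈ K.comps, X ⊆ C → Y ⊆ C → X ≠ Y → ∀ a ∈ X, a ∈ Y → a ∈ W)
    {inC : Fin n → Bool} (hC : ∀ w, inC w = true ↔ w ∈ C) {X : List (Fin n)}
    {xs : List (List (Fin n))} {s : UpdateState n} {t : ℕ}
    (hs : UpdateInv K C W (X :: xs) s t) :
    wp (updateStep inC s X) fun s' t' => UpdateInv K C W xs s' (t + 1 + t') := by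
  obtain ⟨ys, hys, hlog, hnew, ht⟩ := hs.ex
  have hX : X ∈ K.comps := hys ▸ by simp
  have hXnd := h.comps_nodup X hX
  unfold updateStep
  simp only [wp_bind, wp_ite, wp_pure, wp_cons]
  refine wp_mono (wp_subsetTest hC hXnd (h.subset X hX)) ?_
  rintro b t₁ ⟨hb, ht₁⟩
  refine ⟨fun hbt => ?_, fun hbf => ?_⟩
  · have hXC := hb.1 hbt
    refine wp_mono (wp_charVec X) ?_
    rintro inX t₂ ⟨hinX, rfl⟩
    refine wp_mono (wp_listDiff hs.nodup inX) ?_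
    rintro A t₃ ⟨⟨hA, hAnd⟩, ht₃⟩
    refine wp_mono (wp_listDiff hXnd s.inU) ?_
    rintro B t₄ ⟨⟨hB, hBnd⟩, ht₄⟩
    refine wp_mono (wp_markBoth A B s.data) ?_
    rintro K' t₅ ⟨hK', rfl⟩
    simp only [ne_eq, hinX] at hA
    simp only [ne_eq, hs.inU] at hB
    refine wp_mono (wp_forEach_le 2 (fun zs (V : List (Fin n) × (Fin n → Bool)) => zs.Nodup ∧
      zs ⊆ B ∧ V.1.Nodup ∧ (∀ w, w ∈ V.1 ↔ w ∈ s.U ∨ (w ∈ B ∧ w ∉ zs)) ∧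
        ∀ w, V.2 w = true ↔ w ∈ V.1) ?_ ?_) ?_
    · exact ⟨hBnd, List.Subset.refl _, hs.nodup, by simp, hs.inU⟩
    · rintro z zs ⟨V, inV⟩ ⟨hz, hsub, hV, hmem, hin⟩
      obtain ⟨hz, hznd⟩ := List.nodup_cons.1 hz
      obtain ⟨hzB, hsub⟩ := List.cons_subset.1 hsub
      simp only [wp_bind, wp_cons, wp_write, wp_pure]
      dsimp only at hV hmem hin
      refine ⟨⟨hznd, hsub, List.nodup_cons.2 ⟨fun hzV => ?_, hV⟩, fun w => ?_, fun w => ?_⟩,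
        by omega⟩
      · rcases (hmem z).1 hzV with h | h
        · exact ((hB z).1 hzB).2 h
        · exact h.2 List.mem_cons_self
      · rw [List.mem_cons, hmem, List.mem_cons]
        by_cases hw : w = z
        · subst hw
          simp [hz, hzB]
        · simp [hw]
      · by_cases hw : w = z
        · simp [hw]
        · simp [hw, hin]
    · rintro ⟨V, inV⟩ t₆ ⟨⟨-, -, hV, hmem, hin⟩, ht₆⟩
      dsimp only at hV hmem hin
      have hmemV : ∀ w, w ∈ V ↔ w ∈ s.U ∨ w ∈ X := by
        intro w
        rw [hmem, hB]
        by_cases hw : w ∈ s.U <;> simp [hw]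
      have hdisj : Disjoint (A.toFinset ×ˢ B.toFinset) (B.toFinset ×ˢ A.toFinset) := by
        rw [Finset.disjoint_left]
        rintro ⟨a, b⟩ h1 h2
        rw [Finset.mem_product, List.mem_toFinset, List.mem_toFinset] at h1 h2
        exact ((hA a).1 h1.1).2 ((hB a).1 h2.1).1
      have hcard : (A.toFinset ×ˢ B.toFinset ∪ B.toFinset ×ˢ A.toFinset).card =
          2 * (A.length * B.length) := by
        rw [Finset.card_union_of_disjoint hdisj, Finset.card_product, Finset.card_product,
          List.toFinset_card_of_nodup hAnd, List.toFinset_card_of_nodup hBnd]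
        ring
      have hred := (hcard.symm ▸ hK' : Marked _ _ _ _).redundant_eq
      have hcount := hK'.count
      have hlenU := nodup_length_le hs.nodup
      have hlenX := nodup_length_le hXnd
      have hlenA := nodup_length_le hAnd
      have hlenB := nodup_length_le hBnd
      refine ⟨⟨ys ++ [X], ?_, ?_, ?_, ?_⟩, hK'.merged.trans hs.merged, hV, ?_, hin, ?_, ?_⟩
      · simp [hys]
      · simp [hlog, List.filter_append, hXC]
      · simp [hnew, List.filter_append, hXC]
      · simp only [List.length_append, List.length_singleton, Nat.mul_add, Nat.mul_one] at ht ⊢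
        have : A.length * (3 * B.length) = 3 * (A.length * B.length) := by ring
        omega
      · intro w
        rw [hmemV, hs.mem_U]
        simp [or_and_right, exists_or]
      · rw [hK'.ones_eq, hs.ones_eq]
        ext ⟨a, b⟩
        simp only [Finset.mem_union, Finset.mem_product, List.mem_toFinset, hA, hB, hmemV, mem_ones]
        have hXM : a ∈ X → b ∈ X → K.M (a, b) = true := fun ha hb => (h.M_iff a b).2 ⟨X, hX, ha, hb⟩
        clear * - hXM
        tauto
      · have hUV : (W ∩ V.toFinset).card =
            (W ∩ s.U.toFinset).card + (W ∩ B.toFinset).card := by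
          rw [← Finset.card_union_of_disjoint]
          · congr 1
            ext w
            simp only [Finset.mem_inter, Finset.mem_union, List.mem_toFinset, hmemV, hB]
            clear * -
            tauto
          · rw [Finset.disjoint_left]
            intro w h1 h2
            simp only [Finset.mem_inter, List.mem_toFinset, hB] at h1 h2
            exact h2.2.2 h1.2
        have h1 := hs.card_inter_le h hW hXC (A := A.toFinset) (B := B.toFinset)
          (fun w => by rw [List.mem_toFinset, hA]) fun w => by rw [List.mem_toFinset, hB]
        have h2 := hs.redundant
        change K'.redundant ≤ K.redundant + (W ∩ V.toFinset).card ^ 2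
        -- The new redundant writes number at most twice the product of the two parts of `W`:
        -- exactly the cross term when the square of `|W ∩ U|` grows.
        rw [hUV, hred, add_sq]
        calc _ ≤ K.redundant + (W ∩ s.U.toFinset).card ^ 2 +
              2 * ((W ∩ s.U.toFinset).card * (W ∩ B.toFinset).card) := Nat.add_le_add h2 h1
          _ ≤ _ := by
            rw [Nat.mul_assoc 2, Nat.add_assoc]
            exact Nat.add_le_add_left (Nat.le_add_right _ _) _
  · have hXC : ¬X ⊆ C := fun h => hbf (hb.2 h)
    refine ⟨⟨ys ++ [X], by simp [hys], ?_, ?_, ?_⟩, hs.merged, hs.nodup, hs.mem_U, hs.inU,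
      hs.ones_eq, hs.redundant⟩
    · simp [hlog, List.filter_append, hXC]
    · simp [hnew, List.filter_append, hXC]
    · simp only [List.length_append, List.length_singleton]
      omega

theorem wp_updateComponents {K : CompData n} {C : List (Fin n)} {W : Finset (Fin n)}
    (h : Updatable K C)
    (hW : ∀ X ∈ K.comps, ∀ Y ∈ K.comps, X ⊆ C → Y ⊆ C → X ≠ Y → ∀ a ∈ X, a ∈ Y → a ∈ W) :
    wp (updateComponents C K) fun K' t =>
      (K'.comps = (K.comps.filter (fun X => !decide (X ⊆ C))).reverse ++ [C] ∧
        K'.merged = K.comps.filter (fun X => decide (X ⊆ C)) :: K.merged ∧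
        ones K'.M = ones K.M ∪ C.toFinset ×ˢ C.toFinset ∧
        K'.redundant ≤ K.redundant + W.card ^ 2 + n) ∧
      t + 2 * ((ones K.M).card + K.redundant) ≤ 6 * K.comps.length +
        30 * (n + 1) * ((K.comps.filter fun X => decide (X ⊆ C)).length + 1) +
        2 * ((ones K'.M).card + K'.redundant) := by
  unfold updateComponents
  simp only [wp_bind, wp_alloc, Fintype.card_fin, wp_cons, wp_pure]
  refine wp_mono (wp_charVec C) ?_
  rintro inC t₁ ⟨hinC, rfl⟩
  refine wp_mono (wp_forEach (Q := fun s t => ∃ t', t = t' + 1 ∧ UpdateInv K C W [] s t')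
    (UpdateInv K C W) ?_ (fun X xs s t hs => wp_updateStep h hW hinC hs)
    fun s t hs => ⟨t, rfl, hs⟩) ?_
  · refine ⟨⟨[], by simp⟩, rfl, List.nodup_nil, by simp, by simp, by simp, by simp⟩
  rintro s _ ⟨t₂, rfl, hs⟩
  obtain ⟨ys, hys, hlog, hnew, ht⟩ := hs.ex
  rw [List.append_nil] at hys
  subst hys
  refine wp_mono (wp_listDiff h.nodup s.inU) ?_
  rintro R t₃ ⟨⟨hR, hRnd⟩, ht₃⟩
  simp only [ne_eq, hs.inU] at hR
  refine wp_mono (wp_markBoth s.U R s.data) ?_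
  rintro K₁ t₄ ⟨h1, rfl⟩
  refine wp_mono (wp_markOnce R R K₁) ?_
  rintro K₂ t₅ ⟨h2, rfl⟩
  have hUC : ∀ w ∈ s.U, w ∈ C := by
    intro w hw
    obtain ⟨X, hX, hwX⟩ := (hs.mem_U w).1 hw
    rw [hlog, List.mem_filter, decide_eq_true_eq] at hX
    exact hX.2 hwX
  have hcard1 : (s.U.toFinset ×ˢ R.toFinset ∪ R.toFinset ×ˢ s.U.toFinset).card =
      2 * (s.U.length * R.length) := by
    rw [Finset.card_union_of_disjoint, Finset.card_product, Finset.card_product,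
      List.toFinset_card_of_nodup hs.nodup, List.toFinset_card_of_nodup hRnd]
    · ring
    · rw [Finset.disjoint_left]
      rintro ⟨a, b⟩ h1 h2
      rw [Finset.mem_product, List.mem_toFinset, List.mem_toFinset] at h1 h2
      exact ((hR b).1 h1.2).2 h2.2
  have hcard2 : (R.toFinset ×ˢ R.toFinset).card = R.length * R.length := by
    rw [Finset.card_product, List.toFinset_card_of_nodup hRnd]
  have hred1 := (hcard1.symm ▸ h1 : Marked _ _ _ _).redundant_eq
  have hred2 := (hcard2.symm ▸ h2 : Marked _ _ _ _).redundant_eq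
  -- An old one joining two different vertices of `C` comes from a component inside `C`, and that
  -- component has been merged into `U`. Hence the final `U × R` writes are never redundant, and the
  -- `R × R` writes only on the diagonal.
  have hpair : ∀ a b, a ∈ C → b ∈ C → (a ∉ s.U ∨ b ∉ s.U) → K.M (a, b) = true → a = b := by
    intro a b ha hb hU hM
    by_contra hab
    obtain ⟨Y, hY, haY, hbY⟩ := (h.M_iff a b).1 hM
    have hYC := h.subset Y hY a haY b hbY hab ha hb
    have hYlog : Y ∈ s.log := by
      rw [hlog, List.mem_filter, decide_eq_true_eq]
      exact ⟨hY, hYC⟩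
    exact hU.elim (fun h => h ((hs.mem_U a).2 ⟨Y, hYlog, haY⟩))
      fun h => h ((hs.mem_U b).2 ⟨Y, hYlog, hbY⟩)
  have hzero : ones s.data.M ∩ (s.U.toFinset ×ˢ R.toFinset ∪ R.toFinset ×ˢ s.U.toFinset) = ∅ := by
    rw [hs.ones_eq, Finset.eq_empty_iff_forall_notMem]
    rintro ⟨a, b⟩ hab
    simp only [Finset.mem_inter, Finset.mem_union, Finset.mem_product, List.mem_toFinset, hR,
      mem_ones] at hab
    obtain ⟨h3, ⟨h4, h5, h6⟩ | ⟨⟨h4, h5⟩, h6⟩⟩ := hab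
    · rcases h3 with h3 | h3
      · exact h6 (hpair a b (hUC a h4) h5 (Or.inr h6) h3 ▸ h4)
      · exact h6 h3.2
    · rcases h3 with h3 | h3
      · exact h5 ((hpair a b h4 (hUC b h6) (Or.inl h5) h3).symm ▸ h6)
      · exact h5 h3.1
  have hdiag : (ones K₁.M ∩ R.toFinset ×ˢ R.toFinset).card ≤ n := by
    have : ones K₁.M ∩ R.toFinset ×ˢ R.toFinset ⊆ Finset.univ.image fun a : Fin n => (a, a) := by
      rw [h1.ones_eq, hs.ones_eq]
      rintro ⟨a, b⟩ hab
      simp only [Finset.mem_inter, Finset.mem_union, Finset.mem_product, List.mem_toFinset, hR,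
        mem_ones] at hab
      obtain ⟨h3, ⟨h4, h5⟩, h6, h7⟩ := hab
      have : a = b := by
        refine hpair a b h4 h6 (Or.inl h5) ?_
        tauto
      simp [this]
    exact ((Finset.card_le_card this).trans Finset.card_image_le).trans (by simp)
  refine ⟨⟨by rw [hnew], ?_, ?_, ?_⟩, ?_⟩
  · simp only [hlog, h2.merged, h1.merged, hs.merged]
  · rw [h2.ones_eq, h1.ones_eq, hs.ones_eq]
    ext ⟨a, b⟩
    simp only [Finset.mem_union, Finset.mem_product, List.mem_toFinset, hR]
    have := hUC a
    have := hUC b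
    tauto
  · rw [hred2, hred1, hzero, Finset.card_empty]
    have h3 := hs.redundant
    have h4 := Nat.pow_le_pow_left
      (Finset.card_le_card (Finset.inter_subset_left (s₁ := W) (s₂ := s.U.toFinset))) 2
    omega
  · have h3 := h1.count
    have h4 := h2.count
    have h5 := nodup_length_le hs.nodup
    have h6 := nodup_length_le hRnd
    have h7 := nodup_length_le h.nodup
    rw [← hlog]
    have h8 : s.U.length * (3 * R.length) = 3 * (s.U.length * R.length) := by ring
    have h9 : R.length * (2 * R.length) = 2 * (R.length * R.length) := by ring
    simp only [Nat.mul_add, Nat.mul_one] at ht ⊢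
    omega

end Update

/-! ## Inserting an edge -/

section Insert

variable {n m k ℓ : ℕ} {G : MultiGraph n m} {D : Orientation n m}

theorem Consistent.insert (h : Consistent G D) {e : Fin m} (he : e ∉ D.arcs) (b : Bool)
    {x : Fin n} (hx : x = if b = true then G.src e else G.dst e) :
    Consistent G ⟨e :: D.arcs, Function.update D.flip e b,
      Function.update D.indeg x (D.indeg x + 1)⟩ := by
  refine ⟨List.nodup_cons.2 ⟨he, h.nodup⟩, fun z => ?_⟩
  simp only [List.toFinset_cons]
  rw [Finset.sum_insert (by simpa using he), Finset.sum_congr rfl (g := fun e' =>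
    if head G D e' = z then 1 else 0), ← h.indeg_eq]
  · simp only [head, Function.update_self, ← hx]
    by_cases hz : z = x
    · subst hz
      simp [Nat.add_comm]
    · simp [hz, Ne.symm hz]
  · intro e' he'
    have hne : e' ≠ e := fun h => he (by simpa [h] using he')
    simp only [head, Function.update_of_ne hne]
    rfl

/-- If `ϱ(v) ≥ k`, the room left forces `ϱ(u) < k`, so the bound `k` survives whichever end receives
the arc. -/
theorem wp_insertArc (h : Consistent G D) (hk : ∀ x, D.indeg x ≤ k) {e : Fin m}
    (he : e ∉ D.arcs) (hroom : D.indeg (G.src e) + D.indeg (G.dst e) < 2 * k - ℓ) :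
    wp (insertArc k e (G.src e) (G.dst e) D) fun D' t =>
      (Consistent G D' ∧ D'.arcs = e :: D.arcs ∧ (∀ x, D'.indeg x ≤ k) ∧
        D'.indeg (G.src e) + D'.indeg (G.dst e) ≤ 2 * k - ℓ) ∧ t ≤ 7 := by
  unfold insertArc
  simp only [wp_bind, wp_cons, wp_read, wp_lt, wp_ite, wp_write, wp_add, wp_pure,
    decide_eq_true_eq, Nat.not_lt]
  have hne := G.loopless e
  refine ⟨fun hlt => ⟨⟨h.insert he false (by simp), by trivial, fun x => ?_, ?_⟩, by omega⟩,
    fun hge => ⟨⟨h.insert he true (by simp), by trivial, fun x => ?_, ?_⟩, by omega⟩⟩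
  · by_cases hx : x = G.dst e
    · subst hx
      rw [Function.update_self]
      omega
    · rw [Function.update_of_ne hx]
      exact hk x
  · rw [Function.update_self, Function.update_of_ne hne]
    omega
  · by_cases hx : x = G.src e
    · subst hx
      rw [Function.update_self]
      omega
    · rw [Function.update_of_ne hx]
      exact hk x
  · rw [Function.update_self, Function.update_of_ne hne.symm]
    omega

/-! ### How the components change with a new edge -/

variable {F : Finset (Fin m)} {e : Fin m} {T X : Finset (Fin n)}

theorem isBlock_insert_iff (he : e ∉ F) (hX : ¬(G.src e ∈ X ∧ G.dst e ∈ X)) :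
    IsBlock k ℓ G (insert e F) X ↔ IsBlock k ℓ G F X := by
  unfold IsBlock
  rw [inducedEdges_insert he, if_neg hX, Nat.add_zero]

theorem isComponent_insert_iff_of_not_exists (he : e ∉ F)
    (hF : ¬∃ X, IsBlock k ℓ G F X ∧ G.src e ∈ X ∧ G.dst e ∈ X)
    (hF' : ¬∃ X, IsBlock k ℓ G (insert e F) X ∧ G.src e ∈ X ∧ G.dst e ∈ X) :
    IsComponent k ℓ G (insert e F) X ↔ IsComponent k ℓ G F X := by
  have : IsBlock k ℓ G (insert e F) = IsBlock k ℓ G F := by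
    funext X
    by_cases hX : G.src e ∈ X ∧ G.dst e ∈ X
    · exact propext ⟨fun h => absurd ⟨X, h, hX⟩ hF', fun h => absurd ⟨X, h, hX⟩ hF⟩
    · exact propext (isBlock_insert_iff he hX)
  unfold IsComponent
  rw [this]

/-- Only sets containing both ends of `e` can change their status. No old block does, so old blocks
remain blocks; every new block does and is therefore contained in `T`. -/
theorem isComponent_insert_iff (he : e ∉ F)
    (hF : ¬∃ X, IsBlock k ℓ G F X ∧ G.src e ∈ X ∧ G.dst e ∈ X)
    (hT : IsBlock k ℓ G (insert e F) T) (hu : G.src e ∈ T) (hv : G.dst e ∈ T)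
    (hmax : ∀ X, IsBlock k ℓ G (insert e F) X → G.src e ∈ X → G.dst e ∈ X → X ⊆ T) :
    IsComponent k ℓ G (insert e F) X ↔ X = T ∨ IsComponent k ℓ G F X ∧ ¬X ⊆ T := by
  constructor
  · intro hX
    by_cases hXT : X ⊆ T
    · exact Or.inl (hX.eq_of_le hT hXT)
    · have hno : ¬(G.src e ∈ X ∧ G.dst e ∈ X) := fun h => hXT (hmax X hX.1 h.1 h.2)
      refine Or.inr ⟨⟨(isBlock_insert_iff he hno).1 hX.1, fun Y hY hXY => ?_⟩, hXT⟩
      exact hX.2 ((isBlock_insert_iff he fun h => hF ⟨Y, hY, h⟩).2 hY) hXY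
  · rintro (rfl | ⟨hX, hXT⟩)
    · exact ⟨hT, fun Y hY hXY => hmax Y hY (hXY hu) (hXY hv)⟩
    · refine ⟨(isBlock_insert_iff he fun h => hF ⟨X, hX.1, h⟩).2 hX.1, fun Y hY hXY => ?_⟩
      by_cases hYe : G.src e ∈ Y ∧ G.dst e ∈ Y
      · exact absurd (hXY.trans (hmax Y hY hYe.1 hYe.2)) hXT
      · exact hX.2 ((isBlock_insert_iff he hYe).1 hY) hXY

end Insert

/-! ## The invariant of the pebble game -/

section Game

variable {n m k ℓ : ℕ} {G : MultiGraph n m}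

/-- The number of components merged so far. -/
def mergeCount (K : CompData n) : ℕ := (K.merged.map List.length).sum

/-- The component data describe the components of `(V, F)`. -/
structure Represents (k ℓ : ℕ) (G : MultiGraph n m) (F : Finset (Fin m)) (K : CompData n) :
    Prop where
  nodup : ∀ X ∈ K.comps, X.Nodup
  ne_nil : ∀ X ∈ K.comps, X ≠ []
  mem_iff : ∀ X : Finset (Fin n), X ∈ K.comps.map List.toFinset ↔
    X.Nonempty ∧ IsComponent k ℓ G F X
  map_nodup : (K.comps.map List.toFinset).Nodup
  M_iff : ∀ a b, K.M (a, b) = true ↔ ∃ X ∈ K.comps, a ∈ X ∧ b ∈ X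

theorem Represents.isComponent {F : Finset (Fin m)} {K : CompData n} (h : Represents k ℓ G F K)
    {X : List (Fin n)} (hX : X ∈ K.comps) : IsComponent k ℓ G F X.toFinset :=
  ((h.mem_iff _).1 (List.mem_map_of_mem hX)).2

theorem Represents.M_iff_exists_isComponent {F : Finset (Fin m)} {K : CompData n}
    (h : Represents k ℓ G F K) (a b : Fin n) :
    K.M (a, b) = true ↔ ∃ X, IsComponent k ℓ G F X ∧ a ∈ X ∧ b ∈ X := by
  rw [h.M_iff]
  constructor
  · rintro ⟨X, hX, ha, hb⟩
    exact ⟨X.toFinset, h.isComponent hX, List.mem_toFinset.2 ha, List.mem_toFinset.2 hb⟩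
  · rintro ⟨X, hX, ha, hb⟩
    obtain ⟨Y, hY, rfl⟩ := List.mem_map.1 ((h.mem_iff X).2 ⟨⟨a, ha⟩, hX⟩)
    exact ⟨Y, hY, List.mem_toFinset.1 ha, List.mem_toFinset.1 hb⟩

/-- The counters of the component data, for `a` accepted edges. -/
structure Counters (K : CompData n) (a : ℕ) : Prop where
  comps : K.comps.length + mergeCount K ≤ n + a
  calls : K.merged.length ≤ a
  redundant : K.redundant ≤ 4 * mergeCount K ^ 2 + n * K.merged.length
  overlap : ∀ L ∈ K.merged, 2 ≤ L.length → overlapSum ∅ L < 2 * (L.length - 1)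

theorem Counters.mono {K : CompData n} {a b : ℕ} (h : Counters K a) (hab : a ≤ b) : Counters K b :=
  ⟨h.comps.trans (by omega), h.calls.trans hab, h.redundant, h.overlap⟩

theorem wp_updateComponents_of_represents (hℓ : ℓ < 2 * k) {F : Finset (Fin m)} {K : CompData n}
    {e : Fin m} {C : List (Fin n)} {a : ℕ} (hK : Represents k ℓ G F K) (ha : Counters K a)
    (hF : IsSparse k ℓ G F) (hF' : IsSparse k ℓ G (insert e F)) (he : e ∉ F)
    (hno : ¬∃ X, IsBlock k ℓ G F X ∧ G.src e ∈ X ∧ G.dst e ∈ X) (hnd : C.Nodup)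
    (hC : IsBlock k ℓ G (insert e F) C.toFinset) (hu : G.src e ∈ C) (hv : G.dst e ∈ C)
    (hmax : ∀ X, IsBlock k ℓ G (insert e F) X → G.src e ∈ X → G.dst e ∈ X → X ⊆ C.toFinset) :
    wp (updateComponents C K) fun K' t =>
      (Represents k ℓ G (insert e F) K' ∧ Counters K' (a + 1)) ∧
        t + 30 * (n + 1) * mergeCount K + 2 * ((ones K.M).card + K.redundant) ≤
          6 * K.comps.length + 30 * (n + 1) + 30 * (n + 1) * mergeCount K' +
            2 * ((ones K'.M).card + K'.redundant) := by
  have hcomp : ∀ X, IsComponent k ℓ G (insert e F) X ↔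
      X = C.toFinset ∨ IsComponent k ℓ G F X ∧ ¬X ⊆ C.toFinset := fun X =>
    isComponent_insert_iff he hno hC (List.mem_toFinset.2 hu) (List.mem_toFinset.2 hv) hmax
  have hsubset : ∀ X : List (Fin n), X.toFinset ⊆ C.toFinset ↔ X ⊆ C := fun X => by
    simp [Finset.subset_iff, List.subset_def]
  set L := K.comps.filter (fun X => decide (X ⊆ C)) with hL
  have hLmem : ∀ X, X ∈ L ↔ X ∈ K.comps ∧ X ⊆ C := fun X => by
    rw [hL, List.mem_filter, decide_eq_true_eq]
  have hoverlap : 2 ≤ L.length → overlapSum ∅ L < 2 * (L.length - 1) := by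
    refine overlapSum_lt hℓ hF L (fun X hX => ?_) (hK.map_nodup.sublist ?_)
    · have := ((hLmem X).1 hX).1
      exact ⟨hK.ne_nil X this, hK.isComponent this⟩
    · exact List.filter_sublist.map _
  obtain ⟨W, hWcard, -, hW⟩ := exists_card_le_overlapSum L ∅
  -- With fewer than two merged sets there is no overlap at all; otherwise `overlapSum_lt` applies.
  have hWle : W.card ≤ 2 * L.length := by
    rcases L with _ | ⟨X, _ | ⟨Y, L⟩⟩
    · simpa [overlapSum] using hWcard
    · simp [overlapSum] at hWcard
      simp [hWcard]
    · have := hoverlap (by simp)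
      omega
  have hUpd : Updatable K C := by
    refine ⟨hnd, hK.nodup, fun X hX a haX b hbX hab haC hbC => ?_, hK.M_iff⟩
    -- An old component sharing two vertices with `C` has a block as its union with `C`. That block
    -- contains both ends of `e`, so maximality of `C` absorbs it.
    have hcard : 2 ≤ (X.toFinset ∩ C.toFinset).card :=
      Finset.one_lt_card.2 ⟨a, by simp [haX, haC], b, by simp [hbX, hbC], hab⟩
    have hU := ((hK.isComponent hX).1.mono hF' (Finset.subset_insert e F)).union hℓ hF' hC hcard
    exact (hsubset X).1 (Finset.subset_union_left.trans (hmax _ hU (by simp [hu]) (by simp [hv])))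
  have hsymm : Std.Symm fun X Y : List (Fin n) => ∀ a ∈ X, a ∈ Y → a ∈ W :=
    ⟨fun X Y h a ha hb => h a hb ha⟩
  refine wp_mono (wp_updateComponents (W := W) hUpd fun X hX Y hY hXC hYC hne =>
    hW.forall ((hLmem X).2 ⟨hX, hXC⟩) ((hLmem Y).2 ⟨hY, hYC⟩) hne) ?_
  rintro K' t ⟨⟨h1, h2, h3, h4⟩, ht⟩
  rw [← hL] at h2 ht
  have hmem : ∀ X, X ∈ K'.comps ↔ X ∈ K.comps ∧ ¬X ⊆ C ∨ X = C := fun X => by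
    simp [h1]
  have hmerge : mergeCount K' = L.length + mergeCount K := by
    simp [mergeCount, h2]
  refine ⟨⟨⟨fun X hX => ?_, fun X hX => ?_, fun X => ?_, ?_, fun a b => ?_⟩, ⟨?_, ?_, ?_, ?_⟩⟩, ?_⟩
  · rcases (hmem X).1 hX with h | rfl
    · exact hK.nodup X h.1
    · exact hnd
  · rcases (hmem X).1 hX with h | rfl
    · exact hK.ne_nil X h.1
    · exact List.ne_nil_of_mem hu
  · rw [hcomp]
    constructor
    · intro hX
      obtain ⟨Y, hY, rfl⟩ := List.mem_map.1 hX
      rcases (hmem Y).1 hY with h | rfl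
      · have := (hK.mem_iff _).1 (List.mem_map_of_mem h.1)
        exact ⟨this.1, Or.inr ⟨this.2, fun h' => h.2 ((hsubset Y).1 h')⟩⟩
      · exact ⟨⟨_, List.mem_toFinset.2 hu⟩, Or.inl rfl⟩
    · rintro ⟨hne, rfl | ⟨hX, hXC⟩⟩
      · exact List.mem_map_of_mem ((hmem C).2 (Or.inr rfl))
      · obtain ⟨Y, hY, rfl⟩ := List.mem_map.1 ((hK.mem_iff X).2 ⟨hne, hX⟩)
        exact List.mem_map_of_mem ((hmem Y).2 (Or.inl ⟨hY, fun h => hXC ((hsubset Y).2 h)⟩))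
  · rw [h1, List.map_append, List.map_reverse, List.nodup_append]
    refine ⟨List.nodup_reverse.2 (hK.map_nodup.sublist (List.filter_sublist.map _)), by simp, ?_⟩
    intro X hX Y hY hXY
    obtain ⟨Z, hZ, rfl⟩ := List.mem_map.1 (List.mem_reverse.1 hX)
    obtain rfl : Y = C.toFinset := by simpa using hY
    have := (List.mem_filter.1 hZ).2
    simp only [Bool.not_eq_true', decide_eq_false_iff_not] at this
    exact this ((hsubset Z).1 hXY.subset)
  · rw [← mem_ones, h3, Finset.mem_union, mem_ones, hK.M_iff, Finset.mem_product,
      List.mem_toFinset, List.mem_toFinset]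
    constructor
    · rintro (⟨X, hX, ha, hb⟩ | h)
      · by_cases hXC : X ⊆ C
        · exact ⟨C, (hmem C).2 (Or.inr rfl), hXC ha, hXC hb⟩
        · exact ⟨X, (hmem X).2 (Or.inl ⟨hX, hXC⟩), ha, hb⟩
      · exact ⟨C, (hmem C).2 (Or.inr rfl), h⟩
    · rintro ⟨X, hX, hab⟩
      rcases (hmem X).1 hX with h | rfl
      · exact Or.inl ⟨X, h.1, hab⟩
      · exact Or.inr hab
  · have h5 := ha.comps
    have h6 := List.length_eq_length_filter_add (l := K.comps) fun X => decide (X ⊆ C)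
    rw [← hL] at h6
    rw [h1, hmerge, List.length_append, List.length_reverse, List.length_singleton]
    omega
  · rw [h2, List.length_cons]
    exact Nat.succ_le_succ ha.calls
  · have h5 := ha.redundant
    have h6 := Nat.pow_le_pow_left hWle 2
    rw [h2, hmerge, List.length_cons]
    -- The call adds at most `(2t)² + n`, and `t² + s² ≤ (t + s)²` absorbs the square into the
    -- global count of merges.
    nlinarith [Nat.zero_le (L.length * mergeCount K)]
  · intro L' hL'
    rw [h2] at hL'
    rcases List.mem_cons.1 hL' with rfl | hL'
    · exact hoverlap
    · exact ha.overlap L' hL'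
  · rw [hmerge]
    simp only [Nat.mul_add, Nat.mul_one] at ht ⊢
    omega

/-- The invariant of the pebble game: the edges of `es` remain, after `t` steps; `t₀` steps have
been spent on the initialization. -/
structure GameInv (k ℓ : ℕ) (G : MultiGraph n m) (t₀ : ℕ) (es : List (Fin m))
    (s : Orientation n m × CompData n) (t : ℕ) : Prop where
  suffix : es <:+ List.finRange m
  consistent : Consistent G s.1
  indeg_le : ∀ x, s.1.indeg x ≤ k
  notMem : ∀ e ∈ s.1.arcs, e ∉ es
  sparse : IsSparse k ℓ G s.1.arcs.toFinset
  rejected : ∀ e, e ∉ es → e ∉ s.1.arcs →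
    ∃ X, IsBlock k ℓ G (s.1.arcs.toFinset.filter (· ≤ e)) X ∧ G.src e ∈ X ∧ G.dst e ∈ X
  represents : Represents k ℓ G s.1.arcs.toFinset s.2
  counters : Counters s.2 s.1.arcs.length
  time : t₀ + t + 5 * es.length ≤ t₀ + 5 * m +
    200 * (ℓ + 1) * ((k + 1) * n + 1) * s.1.arcs.length +
    30 * (n + 1) * mergeCount s.2 + 2 * ((ones s.2.M).card + s.2.redundant)

theorem lt_of_suffix_finRange {e : Fin m} {es : List (Fin m)} (h : e :: es <:+ List.finRange m)
    {f : Fin m} (hf : f ∉ e :: es) : f < e := by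
  obtain ⟨ds, hds⟩ := h
  have hmem := List.mem_finRange f
  have hpw := List.pairwise_lt_finRange m
  rw [← hds] at hmem hpw
  exact (List.pairwise_append.1 hpw).2.2 f ((List.mem_append.1 hmem).resolve_right hf) e
    List.mem_cons_self

theorem notMem_of_suffix_finRange {e : Fin m} {es : List (Fin m)}
    (h : e :: es <:+ List.finRange m) : e ∉ es :=
  (List.nodup_cons.1 ((List.nodup_finRange m).sublist h.sublist)).1

/-- The 5 steps reserved per edge pay for a rejection. An accepted edge draws its search costs and
the fixed part of the update from the term counting arcs; merges and writes are paid by their own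
counters. -/
theorem wp_processEdge (hℓ : ℓ < 2 * k) {t₀ : ℕ} {e : Fin m} {es : List (Fin m)}
    {s : Orientation n m × CompData n} {t : ℕ} (h : GameInv k ℓ G t₀ (e :: es) s t) :
    wp (processEdge k ℓ G s e) fun s' t' => GameInv k ℓ G t₀ es s' (t + 1 + t') := by
  obtain ⟨D, K⟩ := s
  have hsuf : es <:+ List.finRange m := (List.suffix_cons e es).trans h.suffix
  have heF : e ∉ D.arcs := fun he => h.notMem e he List.mem_cons_self
  have htime := h.time
  have hlt : ∀ f ∈ D.arcs, f < e := fun f hf => lt_of_suffix_finRange h.suffix (h.notMem f hf)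
  unfold processEdge inCommonComponent
  simp only [wp_bind, wp_read, wp_ite, wp_pure]
  simp only [List.length_cons] at htime
  refine ⟨fun hM => ?_, fun hM => ?_⟩
  · refine ⟨hsuf, h.consistent, h.indeg_le, fun f hf hf' => h.notMem f hf
      (List.mem_cons_of_mem _ hf'), h.sparse, fun f hf hfD => ?_, h.represents, h.counters, ?_⟩
    · by_cases hfe : f = e
      · subst hfe
        obtain ⟨X, hX, hX'⟩ := (h.represents.M_iff_exists_isComponent _ _).1 hM
        refine ⟨X, ?_, hX'⟩
        -- At the moment of rejection all accepted edges precede `e`, so the current block is a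
        -- block of the accepted prefix.
        rw [Finset.filter_true_of_mem fun d hd => (hlt d (List.mem_toFinset.1 hd)).le]
        exact hX.1
      · exact h.rejected f (fun h' => (List.mem_cons.1 h').elim hfe hf) hfD
    · dsimp only at htime ⊢
      omega
  have hno : ¬∃ X, IsBlock k ℓ G D.arcs.toFinset X ∧ G.src e ∈ X ∧ G.dst e ∈ X := by
    rintro ⟨X, hX, hu, hv⟩
    obtain ⟨Y, hY, hXY⟩ := hX.exists_component
    exact hM ((h.represents.M_iff_exists_isComponent _ _).2 ⟨Y, hY, hXY hu, hXY hv⟩)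
  have huv := G.loopless e
  refine wp_mono (wp_makeRoom hℓ h.consistent h.indeg_le h.sparse huv hno) ?_
  rintro D₁ t₁ ⟨⟨hD₁, harcs₁, hk₁, hroom₁⟩, ht₁⟩
  refine wp_mono (wp_insertArc hD₁ hk₁ (harcs₁ ▸ heF) hroom₁) ?_
  rintro D₂ t₂ ⟨⟨hD₂, harcs₂, hk₂, hroom₂⟩, ht₂⟩
  rw [harcs₁] at harcs₂
  have hF₂ : D₂.arcs.toFinset = insert e D.arcs.toFinset := by
    rw [harcs₂, List.toFinset_cons]
  have heF' : e ∉ D.arcs.toFinset := fun he => heF (List.mem_toFinset.1 he)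
  have hsparse : IsSparse k ℓ G D₂.arcs.toFinset := by
    intro X
    by_cases hX : G.src e ∈ X ∧ G.dst e ∈ X
    · have := hD₂.inducedEdges_add_le hk₂ huv hX.1 hX.2
      omega
    · rw [hF₂, inducedEdges_insert heF', if_neg hX]
      exact h.sparse X
  refine wp_mono (wp_findComponent hℓ hD₂ hk₂ hsparse huv hroom₂) ?_
  rintro C t₃ ⟨hC, ht₃⟩
  rw [hF₂] at hC
  have hnotMem : ∀ f ∈ D₂.arcs, f ∉ es := by
    intro f hf
    rw [harcs₂] at hf
    rcases List.mem_cons.1 hf with rfl | hf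
    · exact notMem_of_suffix_finRange h.suffix
    · exact fun hf' => h.notMem f hf (List.mem_cons_of_mem _ hf')
  have hrej : ∀ f, f ∉ es → f ∉ D₂.arcs →
      ∃ X, IsBlock k ℓ G (D₂.arcs.toFinset.filter (· ≤ f)) X ∧ G.src f ∈ X ∧ G.dst f ∈ X := by
    intro f hf hfD
    rw [harcs₂, List.mem_cons, not_or] at hfD
    obtain ⟨X, hX, hX'⟩ := h.rejected f (fun h' => (List.mem_cons.1 h').elim hfD.1 hf) hfD.2
    refine ⟨X, hX.mono (hsparse.mono (Finset.filter_subset _ _)) ?_, hX'⟩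
    exact Finset.filter_subset_filter _ (hF₂ ▸ Finset.subset_insert _ _)
  have hlen : D₂.arcs.length = D.arcs.length + 1 := by
    rw [harcs₂, List.length_cons]
  have hlen_le : D₂.arcs.length ≤ k * n := by
    rw [← List.toFinset_card_of_nodup hD₂.nodup]
    exact hsparse.card_le
  obtain ⟨P, hP⟩ : ∃ P, P = (k + 1) * n + 1 := ⟨_, rfl⟩
  have hPn : n + k * n + 1 = P := by
    rw [hP]
    ring
  have hstep : t₁ + t₂ + t₃ + 6 * K.comps.length + 30 * (n + 1) + 10 ≤ 200 * (ℓ + 1) * P := by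
    have h1 := h.counters.comps
    have h2 : 58 * (ℓ + 1) * (n + D.arcs.length + 1) ≤ 58 * (ℓ + 1) * P :=
      Nat.mul_le_mul_left _ (by omega)
    have h3 : P ≤ (ℓ + 1) * P := Nat.le_mul_of_pos_left _ (Nat.succ_pos _)
    rw [Nat.mul_assoc] at h2 ht₁ ⊢
    rw [Nat.mul_assoc] at h2
    dsimp only at h1
    omega
  rw [← hP] at htime
  rw [wp_nonempty]
  refine ⟨fun hne => ?_, fun hnil => ?_⟩
  · rcases hC with ⟨rfl, -⟩ | ⟨hCnd, hCb, huC, hvC, hmax⟩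
    · simp at hne
    refine wp_mono (wp_updateComponents_of_represents hℓ h.represents h.counters h.sparse
      (hF₂ ▸ hsparse) heF' hno hCnd hCb huC hvC hmax) ?_
    rintro K' t₄ ⟨⟨hK', hcount⟩, ht₄⟩
    refine ⟨hsuf, hD₂, hk₂, hnotMem, hsparse, hrej, hF₂ ▸ hK', hlen ▸ hcount, ?_⟩
    rw [← hP]
    dsimp only at ht₄ ⊢
    rw [hlen, Nat.mul_succ]
    omega
  · rcases hC with ⟨rfl, hno'⟩ | ⟨-, -, huC, -⟩
    · have hcomp : ∀ X, IsComponent k ℓ G D₂.arcs.toFinset X ↔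
          IsComponent k ℓ G D.arcs.toFinset X := fun X => by
        rw [hF₂]
        exact isComponent_insert_iff_of_not_exists heF' hno hno'
      refine ⟨hsuf, hD₂, hk₂, hnotMem, hsparse, hrej, ⟨h.represents.nodup, h.represents.ne_nil,
        fun X => ?_, h.represents.map_nodup, h.represents.M_iff⟩,
        h.counters.mono (hlen ▸ Nat.le_succ _), ?_⟩
      · rw [hcomp]
        exact h.represents.mem_iff X
      · rw [← hP]
        dsimp only
        rw [hlen, Nat.mul_succ]
        omega
    · simp [List.ne_nil_of_mem huC] at hnil

/-! ### The initial state and the complete run -/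

theorem isComponent_empty_iff (hℓ : ℓ < 2 * k) (hkℓ : k ≤ ℓ) (X : Finset (Fin n)) :
    (X.Nonempty ∧ IsComponent k ℓ G ∅ X) ↔ ∃ a, X = {a} := by
  have hblock : ∀ X : Finset (Fin n), IsBlock k ℓ G ∅ X ↔ X.card ≤ 1 := by
    intro X
    have h0 : inducedEdges G ∅ X = 0 := by simp [inducedEdges]
    rw [IsBlock, h0]
    constructor
    · intro h
      by_contra! hlt
      have := lt_mul_card hℓ hlt
      omega
    · intro h
      -- For `k ≤ ℓ` the bound of a single vertex is truncated to `0`, so singletons are blocks of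
      -- the empty graph.
      have := Nat.mul_le_mul_left k h
      omega
  constructor
  · rintro ⟨hne, hX⟩
    have := (hblock X).1 hX.1
    have := Finset.card_pos.2 hne
    exact Finset.card_eq_one.1 (by omega)
  · rintro ⟨a, rfl⟩
    refine ⟨⟨a, Finset.mem_singleton_self a⟩, (hblock _).2 (by simp), fun Y hY haY => ?_⟩
    exact (Finset.eq_of_subset_of_card_le haY (((hblock Y).1 hY).trans (by simp))).symm.subset

theorem wp_initComponents (hℓ : ℓ < 2 * k) (G : MultiGraph n m) :
    wp (initComponents k ℓ n) fun K t =>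
      (Represents k ℓ G ∅ K ∧ Counters K 0) ∧ t ≤ n * n + 4 * n + 3 := by
  unfold initComponents
  simp only [wp_bind, wp_alloc, Fintype.card_prod, Fintype.card_fin, wp_lt, wp_ite, wp_pure,
    decide_eq_true_eq, Nat.not_lt]
  refine ⟨fun hlt => ⟨⟨⟨by simp, by simp, fun X => ?_, by simp, by simp⟩,
    ⟨by simp [mergeCount], by simp, by simp, by simp⟩⟩, by omega⟩, fun hge => ?_⟩
  · simp only [List.map_nil, List.not_mem_nil, false_iff, not_and]
    intro hne hX
    have h1 : inducedEdges G ∅ X = k * X.card - ℓ := hX.1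
    have h2 : k * 1 ≤ k * X.card := Nat.mul_le_mul_left k (Finset.card_pos.2 hne)
    simp only [inducedEdges, Finset.filter_empty, Finset.card_empty] at h1
    omega
  · refine wp_mono (wp_forEach_le (l := List.finRange n) 3 (fun ws (K : CompData n) => ws.Nodup ∧
      K.comps.length + ws.length = n ∧ K.merged = [] ∧ K.redundant = 0 ∧
      (∀ X, X ∈ K.comps ↔ ∃ a, a ∉ ws ∧ X = [a]) ∧ (K.comps.map List.toFinset).Nodup ∧
      ∀ a b, K.M (a, b) = true ↔ a = b ∧ a ∉ ws) ?_ ?_) ?_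
    · exact ⟨List.nodup_finRange n, by simp, rfl, rfl, by simp, by simp, by simp⟩
    · rintro w ws K ⟨hnd, hlen, hmerged, hred, hcomps, hmap, hM⟩
      obtain ⟨hw, hnd⟩ := List.nodup_cons.1 hnd
      unfold setBit
      simp only [wp_bind, wp_write, wp_cons, wp_pure]
      have hMw : ¬K.M (w, w) = true := fun h => ((hM w w).1 h).2 List.mem_cons_self
      refine ⟨⟨hnd, ?_, hmerged, by rw [if_neg hMw, hred], fun X => ?_, ?_, fun a b => ?_⟩, by omega⟩
      · simp only [List.length_cons] at hlen ⊢
        omega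
      · rw [List.mem_cons, hcomps]
        constructor
        · rintro (rfl | ⟨a, ha, rfl⟩)
          · exact ⟨w, hw, rfl⟩
          · exact ⟨a, fun h => ha (List.mem_cons_of_mem _ h), rfl⟩
        · rintro ⟨a, ha, rfl⟩
          by_cases haw : a = w
          · exact Or.inl (haw ▸ rfl)
          · exact Or.inr ⟨a, fun h => (List.mem_cons.1 h).elim haw ha, rfl⟩
      · rw [List.map_cons, List.nodup_cons]
        refine ⟨fun hmem => ?_, hmap⟩
        obtain ⟨X, hX, heq⟩ := List.mem_map.1 hmem
        obtain ⟨a, ha, rfl⟩ := (hcomps X).1 hX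
        obtain rfl : a = w := by simpa using heq
        exact ha List.mem_cons_self
      · by_cases hab : (a, b) = (w, w)
        · obtain ⟨rfl, rfl⟩ := Prod.mk.inj hab
          simp [hw]
        · rw [Function.update_of_ne hab, hM, List.mem_cons]
          refine and_congr_right fun h => ?_
          subst h
          have : a ≠ w := fun h => hab (h ▸ rfl)
          simp [this]
    · rintro K t ⟨⟨-, hlen, hmerged, hred, hcomps, hmap, hM⟩, ht⟩
      rw [List.length_finRange] at ht
      refine ⟨⟨⟨fun X hX => ?_, fun X hX => ?_, fun X => ?_, hmap, fun a b => ?_⟩,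
        ⟨?_, by simp [hmerged], by simp [hred], by simp [hmerged]⟩⟩, by omega⟩
      · obtain ⟨a, -, rfl⟩ := (hcomps X).1 hX
        simp
      · obtain ⟨a, -, rfl⟩ := (hcomps X).1 hX
        simp
      · rw [isComponent_empty_iff hℓ hge, List.mem_map]
        constructor
        · rintro ⟨Y, hY, rfl⟩
          obtain ⟨a, -, rfl⟩ := (hcomps Y).1 hY
          exact ⟨a, by simp⟩
        · rintro ⟨a, rfl⟩
          exact ⟨[a], (hcomps _).2 ⟨a, by simp, rfl⟩, by simp⟩
      · rw [hM]
        constructor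
        · rintro ⟨rfl, -⟩
          exact ⟨[a], (hcomps _).2 ⟨a, by simp, rfl⟩, by simp⟩
        · rintro ⟨X, hX, ha, hb⟩
          obtain ⟨c, -, rfl⟩ := (hcomps X).1 hX
          simp only [List.mem_singleton] at ha hb
          exact ⟨ha.trans hb.symm, by simp⟩
      · simp only [mergeCount, hmerged, List.map_nil, List.sum_nil, List.length_nil] at hlen ⊢
        omega

theorem wp_componentPebbleGame (hℓ : ℓ < 2 * k) (G : MultiGraph n m) :
    wp (componentPebbleGame k ℓ G) fun s t =>
      ∃ t₀ t₁, t = t₀ + t₁ + 1 ∧ t₀ ≤ n * n + 5 * n + m + 5 ∧ GameInv k ℓ G t₀ [] s t₁ := by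
  unfold componentPebbleGame initOrientation
  simp only [wp_bind, wp_alloc, Fintype.card_fin, wp_pure]
  refine wp_mono (wp_initComponents hℓ G) ?_
  rintro K t ⟨⟨hK, hcount⟩, ht⟩
  obtain ⟨t₀, ht₀⟩ : ∃ t₀, t₀ = m + 1 + (n + 1 + 0) + t := ⟨_, rfl⟩
  refine wp_mono (wp_forEach (Q := fun s t => ∃ t₁, t = t₁ + 1 ∧ GameInv k ℓ G t₀ [] s t₁)
    (GameInv k ℓ G t₀) ?_ (fun e es s t hs => wp_processEdge hℓ hs)
    fun s t hs => ⟨t, rfl, hs⟩) ?_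
  · refine ⟨List.suffix_refl _, ⟨List.nodup_nil, by simp⟩, by simp, by simp, ?_, ?_, ?_, hcount, ?_⟩
    · intro X
      simp [inducedEdges]
    · exact fun e he => absurd (List.mem_finRange e) he
    · exact hK
    · simp only [List.length_finRange, List.length_nil]
      omega
  · rintro s t' ⟨t₁, rfl, hs⟩
    exact ⟨t₀, t₁, by omega, by omega, hs⟩

/-! ### The bounds and the optimality of the output -/

theorem GameInv.redundant_le {t₀ t : ℕ} {s : Orientation n m × CompData n}
    (h : GameInv k ℓ G t₀ [] s t) : s.2.redundant ≤ 5 * (k + 1) ^ 2 * n ^ 2 := by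
  have h1 := h.sparse.card_le
  rw [List.toFinset_card_of_nodup h.consistent.nodup] at h1
  have h2 : mergeCount s.2 ≤ (k + 1) * n := by
    have := h.counters.comps
    rw [Nat.add_mul, Nat.one_mul]
    omega
  have h3 := Nat.pow_le_pow_left h2 2
  have h4 := Nat.mul_le_mul_left n (h.counters.calls.trans h1)
  have h5 := h.counters.redundant
  have h6 : n * (k * n) ≤ (k + 1) ^ 2 * n ^ 2 := by
    calc n * (k * n) = k * n ^ 2 := by ring
      _ ≤ (k + 1) ^ 2 * n ^ 2 := Nat.mul_le_mul_right _ (by nlinarith)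
  rw [mul_pow] at h3
  linarith

/-- All counters are O(n²), because at most `k n` edges are accepted and at most `(k + 1) n` sets
merged. The condition `0 < n` is needed to absorb the constant cost of the initialization. -/
theorem GameInv.time_le {t₀ t : ℕ} {s : Orientation n m × CompData n}
    (h : GameInv k ℓ G t₀ [] s t) (h₀ : t₀ ≤ n * n + 5 * n + m + 5) (hn : 0 < n) :
    t₀ + t + 1 ≤ 1000 * (ℓ + 1) * (k + 2) ^ 2 * (n ^ 2 + m) := by
  have h1 := h.sparse.card_le
  rw [List.toFinset_card_of_nodup h.consistent.nodup] at h1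
  have h2 : mergeCount s.2 ≤ (k + 1) * n := by
    have := h.counters.comps
    rw [Nat.add_mul, Nat.one_mul]
    omega
  have h3 := h.redundant_le
  have h4 : (ones s.2.M).card ≤ n ^ 2 := by
    have := Finset.card_le_univ (ones s.2.M)
    rwa [Fintype.card_prod, Fintype.card_fin, ← pow_two] at this
  have h5 := h.time
  rw [List.length_nil] at h5
  have hQ : 1 ≤ (k + 2) ^ 2 := Nat.one_le_pow _ _ (by omega)
  have hL : 1 ≤ ℓ + 1 := by omega
  have hn2 : n ≤ n ^ 2 := Nat.le_self_pow (by omega) n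
  have h6 : ((k + 1) * n + 1) * s.1.arcs.length ≤ (k + 2) ^ 2 * n ^ 2 := by
    calc _ ≤ ((k + 2) * n) * ((k + 2) * n) := Nat.mul_le_mul (by nlinarith) (by nlinarith)
      _ = _ := by ring
  have h7 : (n + 1) * mergeCount s.2 ≤ 2 * ((k + 2) ^ 2 * n ^ 2) := by
    calc _ ≤ (2 * n) * ((k + 1) * n) := Nat.mul_le_mul (by omega) h2
      _ = (k + 1) * (2 * n ^ 2) := by ring
      _ ≤ (k + 2) ^ 2 * (2 * n ^ 2) := Nat.mul_le_mul_right _ (by nlinarith)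
      _ = _ := by ring
  have h8 : 5 * (k + 1) ^ 2 * n ^ 2 ≤ 5 * ((k + 2) ^ 2 * n ^ 2) := by
    rw [Nat.mul_assoc]
    exact Nat.mul_le_mul_left _ (Nat.mul_le_mul_right _ (Nat.pow_le_pow_left (by omega) 2))
  obtain ⟨q, hq⟩ : ∃ q, q = (k + 2) ^ 2 * n ^ 2 := ⟨_, rfl⟩
  obtain ⟨p, hp⟩ : ∃ p, p = (ℓ + 1) * q := ⟨_, rfl⟩
  rw [← hq] at h6 h7 h8
  have h9 : 200 * (ℓ + 1) * ((k + 1) * n + 1) * s.1.arcs.length ≤ 200 * p := by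
    rw [hp, Nat.mul_assoc 200, Nat.mul_assoc 200, Nat.mul_assoc (ℓ + 1)]
    exact Nat.mul_le_mul_left _ (Nat.mul_le_mul_left _ h6)
  have h10 : n ^ 2 ≤ q := hq ▸ Nat.le_mul_of_pos_left _ hQ
  have h11 : q ≤ p := hp ▸ Nat.le_mul_of_pos_left _ hL
  have h12 : m ≤ (ℓ + 1) * (k + 2) ^ 2 * m := Nat.le_mul_of_pos_left _ (Nat.mul_pos hL hQ)
  have h13 : 1000 * (ℓ + 1) * (k + 2) ^ 2 * (n ^ 2 + m) =
      1000 * p + 1000 * ((ℓ + 1) * (k + 2) ^ 2 * m) := by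
    rw [hp, hq]
    ring
  rw [h13]
  rw [Nat.mul_assoc 30] at h5
  rw [← pow_two] at h₀
  omega

/-- Each rejected edge is spanned by a block of the edges accepted before it, so the counting
argument for sparse sets applies within every prefix. This is the prefix hypothesis of the weight
comparison. -/
theorem GameInv.card_filter_le (hℓ : ℓ < 2 * k) {t₀ t : ℕ} {s : Orientation n m × CompData n}
    (h : GameInv k ℓ G t₀ [] s t) {F : Finset (Fin m)} (hF : IsSparse k ℓ G F) (j : Fin m) :
    (F.filter (· ≤ j)).card ≤ (s.1.arcs.toFinset.filter (· ≤ j)).card := by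
  have hj := h.sparse.mono (Finset.filter_subset (· ≤ j) _)
  refine hj.card_le_card hℓ (hF.mono (Finset.filter_subset _ _)) fun e he heF => ?_
  have hej := (Finset.mem_filter.1 he).2
  have heD : e ∉ s.1.arcs := fun he' => heF (Finset.mem_filter.2 ⟨List.mem_toFinset.2 he', hej⟩)
  obtain ⟨X, hX, hX'⟩ := h.rejected e (by simp) heD
  exact ⟨X, hX.mono hj (Finset.monotone_filter_right _ fun f _ hf => le_trans hf hej), hX'⟩

theorem GameInv.card_le (hℓ : ℓ < 2 * k) {t₀ t : ℕ} {s : Orientation n m × CompData n}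
    (h : GameInv k ℓ G t₀ [] s t) {F : Finset (Fin m)} (hF : IsSparse k ℓ G F) :
    F.card ≤ s.1.arcs.toFinset.card := by
  refine h.sparse.card_le_card hℓ hF fun e _ heF => ?_
  obtain ⟨X, hX, hX'⟩ := h.rejected e (by simp) fun he' => heF (List.mem_toFinset.2 he')
  exact ⟨X, hX.mono h.sparse (Finset.filter_subset _ _), hX'⟩

end Game

end PebbleGame

theorem mainTheorem1 (k ℓ : ℕ) (hℓ : ℓ < 2 * k) :
    ∃ c : ℕ, ∀ (n m : ℕ) (G : PebbleGame.MultiGraph n m),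
      ∃ (D : PebbleGame.Orientation n m) (K : PebbleGame.CompData n) (t : ℕ),
        (PebbleGame.componentPebbleGame k ℓ G).EndsWith (D, K) t ∧
        -- running time
        (0 < n → t ≤ c * (n ^ 2 + m)) ∧
        -- the output is a sparse subgraph, of maximum size
        PebbleGame.IsSparse k ℓ G D.arcs.toFinset ∧
        (∀ F : Finset (Fin m), PebbleGame.IsSparse k ℓ G F → F.card ≤ D.arcs.toFinset.card) ∧
        -- the output has maximum weight if the edges are sorted by non-increasing weight
        (∀ w : Fin m → ℝ, Antitone w →
          (∀ F : Finset (Fin m), PebbleGame.IsSparse k ℓ G F →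
            F.card = D.arcs.toFinset.card → ∑ e ∈ F, w e ≤ ∑ e ∈ D.arcs.toFinset, w e) ∧
          ((∀ e, 0 ≤ w e) → ∀ F : Finset (Fin m), PebbleGame.IsSparse k ℓ G F →
            ∑ e ∈ F, w e ≤ ∑ e ∈ D.arcs.toFinset, w e)) ∧
        -- the bit matrix and the component list describe the components of the output
        (∀ u v : Fin n, K.M (u, v) = true ↔
          ∃ X, PebbleGame.IsComponent k ℓ G D.arcs.toFinset X ∧ u ∈ X ∧ v ∈ X) ∧
        (∀ X : Finset (Fin n), X ∈ K.comps.map List.toFinset ↔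
          X.Nonempty ∧ PebbleGame.IsComponent k ℓ G D.arcs.toFinset X) ∧
        -- the redundant writes to the bit matrix
        K.redundant ≤ c * n ^ 2 ∧
        -- the overlaps among the components merged by one call of `UpdateComponents`
        (∀ L ∈ K.merged, 2 ≤ L.length →
          PebbleGame.overlapSum ∅ L < 2 * (L.length - 1)) := by
  refine ⟨1000 * (ℓ + 1) * (k + 2) ^ 2, fun n m G => ?_⟩
  obtain ⟨⟨D, K⟩, t, heq, t₀, t₁, rfl, ht₀, h⟩ := PebbleGame.wp_componentPebbleGame hℓ G
  refine ⟨D, K, _, heq, fun hn => h.time_le ht₀ hn, h.sparse, fun F hF => h.card_le hℓ hF,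
    fun w hw => ⟨fun F hF hcard => ?_, fun hpos F hF => ?_⟩,
    h.represents.M_iff_exists_isComponent, h.represents.mem_iff, ?_, h.counters.overlap⟩
  · exact PebbleGame.sum_le_sum_of_card_prefix_le w hw (h.card_filter_le hℓ hF) (Or.inl hcard)
  · exact PebbleGame.sum_le_sum_of_card_prefix_le w hw (h.card_filter_le hℓ hF) (Or.inr hpos)
  · refine h.redundant_le.trans (Nat.mul_le_mul_right _ (Nat.mul_le_mul ?_ ?_))
    · omega
    · exact Nat.pow_le_pow_left (by omega) 2
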